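/- Graphs here are finite directed graphs in which parallel edges and loops are allowed, with a label from $\{\bullet,\square,\Diamond\}$ on every node and a label from $\{t,f,\square\}$ on every edge; below, an arrow $x\to y$ without a label is a $\square$-labelled edge, and $x\xrightarrow{t}y$, $x\xrightarrow{f}y$ are edges labelled $t$, $f$. Rules $\langle L\leftarrow K\rightarrow R\rangle$ are applied by the double-pushout construction with injective matches satisfying the dangling condition: for an injective, label-preserving morphism $g\colon L\to G$ such that no edge of $G$ outside $g(L)$ is incident to a node of $g(L\setminus K)$, delete $g(L\setminus K)$ and add $R\setminus K$ disjointly. Results are taken up to isomorphism. For a set $\mathcal R$ of rules, $G\Rightarrow_{\mathcal R}H$ is a single rule application, and $G\Rightarrow^*_{\mathcal R}H$ means $G\cong H$ or one or more applications. The inverse of $\langle L\leftarrow K\rightarrow R\rangle$ is $\langle R\leftarrow K\rightarrow L\rangle$, and $\mathcal R^{-1}$ is the set of the inverses. The grammar $EFD$ of extended flow diagrams has no non-terminal labels, the start graph $S=(\bullet\to\square\to\bullet)$, and the set $\mathcal R$ of the following five rules, written $L\Rightarrow R$; the numbered nodes are the nodes of the interface $K$, which has no edges. - seq: $\bullet_1\to\square_2\to\bullet_3\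 \Rightarrow\ \bullet_1\to\square_2\to\bullet\to\square\to\bullet_3$; - while: $\bullet_1\to\square\to\bullet_2\ \Rightarrow\ \bullet_1\to\Diamond$, $\Diamond\xrightarrow{t}\bullet_1$, $\Diamond\xrightarrow{f}\bullet_2$; - ddec: $\bullet_1\to\square\to\bullet_2\ \Rightarrow\ \bullet_1\to\Diamond$, $\Diamond\xrightarrow{t}\bullet_2$, $\Diamond\xrightarrow{f}\bullet_2$; - dec1: $\Diamond_1\xrightarrow{t}\bullet_2\ \Rightarrow\ \Diamond_1\xrightarrow{t}\bullet\to\square\to\bullet_2$; - dec2: $\Diamond_1\xrightarrow{f}\bullet_2\ \Rightarrow\ \Diamond_1\xrightarrow{f}\bullet\to\square\to\bullet_2$. Let $L(EFD)=\{[G] : S\Rightarrow^*_{\mathcal R}G\}$ be the set of isomorphism classes of graphs that it generates. Theorem (Efficient EFD Recognition). The system $EFD^{-1}$ with the rules $\mathcal R^{-1}$ efficiently recognises $L(EFD)$, that is: 1. (recognition) there is a graph $S'$ with $[S']\in L(EFD)$ such that for every graph $G$: $[G]\in L(EFD)$ if and only if $G\Rightarrow^*_{\mathcal R^{-1}}S'$;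 2. (termination) there is no infinite sequence $G_0\Rightarrow_{\mathcal R^{-1}}G_1\Rightarrow_{\mathcal R^{-1}}G_2\Rightarrow_{\mathcal R^{-1}}\cdots$ of graphs; 3. (confluence on the language) whenever $[G]\in L(EFD)$, $G\Rightarrow^*_{\mathcal R^{-1}}H_1$ and $G\Rightarrow^*_{\mathcal R^{-1}}H_2$, there is a graph $M$ with $H_1\Rightarrow^*_{\mathcal R^{-1}}M$ and $H_2\Rightarrow^*_{\mathcal R^{-1}}M$. -/

import Mathlib

/-- A finite directed graph with parallel edges and loops, totally labelled by node labels from `A`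
and edge labels from `B`. -/
structure LGraph (A B : Type) where
  V : Type
  E : Type
  finV : Finite V
  finE : Finite E
  src : E → V
  tgt : E → V
  nodeLabel : V → A
  edgeLabel : E → B

namespace LGraph

variable {A B : Type}

/-- Label preserving graph morphisms. -/
structure Hom (G H : LGraph A B) where
  onV : G.V → H.V
  onE : G.E → H.E
  map_src : ∀ e, onV (G.src e) = H.src (onE e)
  map_tgt : ∀ e, onV (G.tgt e) = H.tgt (onE e)
  map_edgeLabel : ∀ e, G.edgeLabel e = H.edgeLabel (onE e)
  map_nodeLabel : ∀ v, G.nodeLabel v = H.nodeLabel (onV v)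

namespace Hom

def id (G : LGraph A B) : Hom G G :=
  ⟨fun v => v, fun e => e, fun _ => rfl, fun _ => rfl, fun _ => rfl, fun _ => rfl⟩

def comp {G H J : LGraph A B} (g : Hom H J) (f : Hom G H) : Hom G J where
  onV := fun v => g.onV (f.onV v)
  onE := fun e => g.onE (f.onE e)
  map_src := fun e => by rw [f.map_src, g.map_src]
  map_tgt := fun e => by rw [f.map_tgt, g.map_tgt]
  map_edgeLabel := fun e => by rw [f.map_edgeLabel, g.map_edgeLabel]
  map_nodeLabel := fun v => by rw [f.map_nodeLabel, g.map_nodeLabel]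

def Injective {G H : LGraph A B} (f : Hom G H) : Prop :=
  Function.Injective f.onV ∧ Function.Injective f.onE

def Bijective {G H : LGraph A B} (f : Hom G H) : Prop :=
  Function.Bijective f.onV ∧ Function.Bijective f.onE

/-- The inverse of a bijective morphism. -/
noncomputable def inverse {G H : LGraph A B} (f : Hom G H) (hf : f.Bijective) : Hom H G where
  onV := (Equiv.ofBijective f.onV hf.1).symm
  onE := (Equiv.ofBijective f.onE hf.2).symm
  map_src := fun e => by
    rw [Equiv.symm_apply_eq]
    change _ = f.onV _
    rw [f.map_src]
    exact congrArg H.src ((Equiv.ofBijective f.onE hf.2).apply_symm_apply e).symm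
  map_tgt := fun e => by
    rw [Equiv.symm_apply_eq]
    change _ = f.onV _
    rw [f.map_tgt]
    exact congrArg H.tgt ((Equiv.ofBijective f.onE hf.2).apply_symm_apply e).symm
  map_edgeLabel := fun e => by
    rw [f.map_edgeLabel]
    exact congrArg H.edgeLabel ((Equiv.ofBijective f.onE hf.2).apply_symm_apply e).symm
  map_nodeLabel := fun v => by
    rw [f.map_nodeLabel]
    exact congrArg H.nodeLabel ((Equiv.ofBijective f.onV hf.1).apply_symm_apply v).symm

end Hom

def Iso (G H : LGraph A B) : Prop := ∃ f : Hom G H, f.Bijective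

theorem iso_refl (G : LGraph A B) : Iso G G :=
  ⟨Hom.id G, Function.bijective_id, Function.bijective_id⟩

theorem iso_symm {G H : LGraph A B} (h : Iso G H) : Iso H G := by
  obtain ⟨f, hf⟩ := h
  exact ⟨f.inverse hf, Equiv.bijective _, Equiv.bijective _⟩

theorem iso_trans {G H J : LGraph A B} (h₁ : Iso G H) (h₂ : Iso H J) : Iso G J := by
  obtain ⟨f, hf⟩ := h₁
  obtain ⟨g, hg⟩ := h₂
  exact ⟨g.comp f, hg.1.comp hf.1, hg.2.comp hf.2⟩

instance isoSetoid (A B : Type) : Setoid (LGraph A B) :=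
  ⟨Iso, iso_refl, iso_symm, iso_trans⟩

end LGraph

/-- Abstract graphs: isomorphism classes of graphs. -/
def AbstractGraph (A B : Type) : Type 1 := Quotient (LGraph.isoSetoid A B)

/-- The abstract graph `[G]`. -/
def LGraph.cls {A B : Type} (G : LGraph A B) : AbstractGraph A B :=
  Quotient.mk (LGraph.isoSetoid A B) G

/-- A rule `L ← K → R`; the (injective) morphisms exhibit the interface `K` as a subgraph of both
`L` and `R`. -/
structure GRule (A B : Type) where
  L : LGraph A B
  K : LGraph A B
  R : LGraph A B
  left : LGraph.Hom K L
  right : LGraph.Hom K R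
  left_inj : left.Injective
  right_inj : right.Injective

namespace GRule

variable {A B : Type}

/-- The inverse rule `R ← K → L`. -/
def inv (r : GRule A B) : GRule A B :=
  ⟨r.R, r.K, r.L, r.right, r.left, r.right_inj, r.left_inj⟩

/-- The square with sides `k : K → L`, `d : K → D`, `g : L → G`, `i : D → G` shows `G` as the graph
obtained by gluing `L` and `D` along `K` (a pushout along injective morphisms): it commutes,
`g` and `i` are injective, every node and edge of `G` comes from `L` or `D`, and a node or edge of
`L` is identified with one of `D` only if both come from the same node or edge of `K`. -/
structure IsGluing {K L D G : LGraph A B} (k : LGraph.Hom K L) (d : LGraph.Hom K D)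
    (g : LGraph.Hom L G) (i : LGraph.Hom D G) : Prop where
  comm : g.comp k = i.comp d
  inj_g : g.Injective
  inj_i : i.Injective
  coverV : ∀ v : G.V, (∃ x, g.onV x = v) ∨ (∃ y, i.onV y = v)
  coverE : ∀ e : G.E, (∃ x, g.onE x = e) ∨ (∃ y, i.onE y = e)
  overlapV : ∀ x y, g.onV x = i.onV y → ∃ z, k.onV z = x ∧ d.onV z = y
  overlapE : ∀ x y, g.onE x = i.onE y → ∃ z, k.onE z = x ∧ d.onE z = y

/-- `G ⇒ H` by the rule `r`: a double pushout with an injective match `g : L → G`. The graph `D` is,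
up to isomorphism, `G` with `g(L ∖ K)` deleted (it exists exactly if the dangling condition holds: no
edge outside `g(L)` touches a node of `g(L ∖ K)`), and `H` is, up to isomorphism, `D` with `R ∖ K`
added. -/
def DirectDerives (r : GRule A B) (G H : LGraph A B) : Prop :=
  ∃ (D : LGraph A B) (g : LGraph.Hom r.L G) (d : LGraph.Hom r.K D) (h : LGraph.Hom r.R H)
    (i : LGraph.Hom D G) (j : LGraph.Hom D H),
    IsGluing r.left d g i ∧ IsGluing r.right d h j

end GRule

/-- A graph transformation system over the label alphabet `(A, B)`. -/
structure GTSystem (A B : Type) where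
  rules : Set (GRule A B)
  finite_rules : rules.Finite

namespace GTSystem

variable {A B : Type}

/-- The system of all inverse rules. -/
def inverse (T : GTSystem A B) : GTSystem A B :=
  ⟨GRule.inv '' T.rules, T.finite_rules.image _⟩

/-- `G ⇒ H`. -/
def Step (T : GTSystem A B) (G H : LGraph A B) : Prop :=
  ∃ r ∈ T.rules, r.DirectDerives G H

/-- `G ⇒* H`: isomorphism, or one or more direct derivations. -/
def Derives (T : GTSystem A B) (G H : LGraph A B) : Prop :=
  LGraph.Iso G H ∨ Relation.TransGen T.Step G H

def Joinable (T : GTSystem A B) (G H : LGraph A B) : Prop :=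
  ∃ M, T.Derives G M ∧ T.Derives H M

def Terminating (T : GTSystem A B) : Prop :=
  ¬ ∃ f : ℕ → LGraph A B, ∀ n, T.Step (f n) (f (n + 1))

/-- Confluence on a set of abstract graphs (confluence up to garbage). -/
def ConfluentOn (T : GTSystem A B) (D : Set (AbstractGraph A B)) : Prop :=
  ∀ G H₁ H₂ : LGraph A B, G.cls ∈ D → T.Derives G H₁ → T.Derives G H₂ → T.Joinable H₁ H₂

end GTSystem

/-- A subalphabet of `(A, B)`. -/
structure SubAlphabet (A B : Type) where
  nodes : Set A
  edges : Set B

/-- All labels of `G` are in the subalphabet. -/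
def LGraph.Over {A B : Type} (G : LGraph A B) (P : SubAlphabet A B) : Prop :=
  (∀ v, G.nodeLabel v ∈ P.nodes) ∧ (∀ e, G.edgeLabel e ∈ P.edges)

/-- `T` recognises the language `L` over `P`. -/
def GTSystem.Recognises {A B : Type} (T : GTSystem A B) (P : SubAlphabet A B)
    (L : Set (AbstractGraph A B)) : Prop :=
  ∃ S : LGraph A B, S.cls ∈ L ∧ ∀ G : LGraph A B, G.Over P → (G.cls ∈ L ↔ T.Derives G S)

/-- `T` efficiently recognises the language `L` over `P`. -/
def GTSystem.EfficientlyRecognises {A B : Type} (T : GTSystem A B) (P : SubAlphabet A B)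
    (L : Set (AbstractGraph A B)) : Prop :=
  T.Recognises P L ∧ T.Terminating ∧ T.ConfluentOn L

/-- A graph grammar: a system, a subalphabet of non-terminals, and a start graph. -/
structure GraphGrammar (A B : Type) where
  system : GTSystem A B
  nonterminals : SubAlphabet A B
  start : LGraph A B

namespace GraphGrammar

variable {A B : Type}

/-- The labels that are not non-terminals. -/
def terminals (𝒢 : GraphGrammar A B) : SubAlphabet A B :=
  ⟨(𝒢.nonterminals.nodes)ᶜ, (𝒢.nonterminals.edges)ᶜ⟩

/-- The language generated by a grammar. -/
def language (𝒢 : GraphGrammar A B) : Set (AbstractGraph A B) :=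
  {X | ∃ G : LGraph A B, 𝒢.system.Derives 𝒢.start G ∧ G.Over 𝒢.terminals ∧ X = G.cls}

end GraphGrammar

namespace EFD

/-- Node labels: program points `•`, statements `□`, decisions `◇`. -/
inductive NodeLabel
  | point
  | stmt
  | decision
  deriving DecidableEq

/-- Edge labels: `t`, `f`, and `□` (the label of the edges that are drawn without a label). -/
inductive EdgeLabel
  | t
  | f
  | blank
  deriving DecidableEq

open NodeLabel EdgeLabel

/-- The graph with nodes `0, …, n - 1`, node labels `lab`, and edges listed as
(source, label, target). -/
def graph {n m : ℕ} (lab : Fin n → NodeLabel) (edge : Fin m → Fin n × EdgeLabel × Fin n) :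
    LGraph NodeLabel EdgeLabel where
  V := Fin n
  E := Fin m
  finV := inferInstance
  finE := inferInstance
  src := fun e => (edge e).1
  tgt := fun e => (edge e).2.2
  nodeLabel := lab
  edgeLabel := fun e => (edge e).2.1

/-- The rule with the given left and right graphs whose interface consists of `k` nodes and no edges;
the `i`-th interface node is the node `l i` on the left and the node `r i` on the right. -/
def rule {n m n' m' k : ℕ} (lab : Fin n → NodeLabel) (edge : Fin m → Fin n × EdgeLabel × Fin n)
    (lab' : Fin n' → NodeLabel) (edge' : Fin m' → Fin n' × EdgeLabel × Fin n')
    (l : Fin k → Fin n) (r : Fin k → Fin n') (hl : Function.Injective l)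
    (hr : Function.Injective r) (hlab : ∀ i, lab (l i) = lab' (r i)) :
    GRule NodeLabel EdgeLabel where
  L := graph lab edge
  K := graph (m := 0) (fun i => lab (l i)) Fin.elim0
  R := graph lab' edge'
  left := ⟨l, Fin.elim0, fun e => e.elim0, fun e => e.elim0, fun e => e.elim0, fun _ => rfl⟩
  right := ⟨r, Fin.elim0, fun e => e.elim0, fun e => e.elim0, fun e => e.elim0, hlab⟩
  left_inj := ⟨hl, fun e => e.elim0⟩
  right_inj := ⟨hr, fun e => e.elim0⟩

/-- `•₀ → □₁ → •₂  ⇒  •₀ → □₁ → •₃ → □₄ → •₂`, with interface nodes `0, 1, 2`. -/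
def seq : GRule NodeLabel EdgeLabel :=
  rule (n := 3) (m := 2) (n' := 5) (m' := 4) (k := 3)
    ![point, stmt, point] ![(0, blank, 1), (1, blank, 2)]
    ![point, stmt, point, point, stmt]
    ![(0, blank, 1), (1, blank, 3), (3, blank, 4), (4, blank, 2)]
    ![0, 1, 2] ![0, 1, 2] (by decide) (by decide) (by decide)

/-- `•₀ → □ → •₂  ⇒  •₀ → ◇`, `◇ -t→ •₀`, `◇ -f→ •₂`, with interface nodes `0, 2`. -/
def whileLoop : GRule NodeLabel EdgeLabel :=
  rule (n := 3) (m := 2) (n' := 3) (m' := 3) (k := 2)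
    ![point, stmt, point] ![(0, blank, 1), (1, blank, 2)]
    ![point, decision, point] ![(0, blank, 1), (1, t, 0), (1, f, 2)]
    ![0, 2] ![0, 2] (by decide) (by decide) (by decide)

/-- `•₀ → □ → •₂  ⇒  •₀ → ◇`, `◇ -t→ •₂`, `◇ -f→ •₂`, with interface nodes `0, 2`. -/
def ddec : GRule NodeLabel EdgeLabel :=
  rule (n := 3) (m := 2) (n' := 3) (m' := 3) (k := 2)
    ![point, stmt, point] ![(0, blank, 1), (1, blank, 2)]
    ![point, decision, point] ![(0, blank, 1), (1, t, 2), (1, f, 2)]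
    ![0, 2] ![0, 2] (by decide) (by decide) (by decide)

/-- `◇₀ -t→ •₁  ⇒  ◇₀ -t→ •₂ → □₃ → •₁`, with interface nodes `0, 1`. -/
def dec1 : GRule NodeLabel EdgeLabel :=
  rule (n := 2) (m := 1) (n' := 4) (m' := 3) (k := 2)
    ![decision, point] ![(0, t, 1)]
    ![decision, point, point, stmt] ![(0, t, 2), (2, blank, 3), (3, blank, 1)]
    ![0, 1] ![0, 1] (by decide) (by decide) (by decide)

/-- `◇₀ -f→ •₁  ⇒  ◇₀ -f→ •₂ → □₃ → •₁`, with interface nodes `0, 1`. -/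
def dec2 : GRule NodeLabel EdgeLabel :=
  rule (n := 2) (m := 1) (n' := 4) (m' := 3) (k := 2)
    ![decision, point] ![(0, f, 1)]
    ![decision, point, point, stmt] ![(0, f, 2), (2, blank, 3), (3, blank, 1)]
    ![0, 1] ![0, 1] (by decide) (by decide) (by decide)

/-- The rules of the grammar. -/
def system : GTSystem NodeLabel EdgeLabel :=
  ⟨{seq, whileLoop, ddec, dec1, dec2}, by simp⟩

/-- The grammar of extended flow diagrams; there are no non-terminals and the start graph is
`• → □ → •`. -/
def grammar : GraphGrammar NodeLabel EdgeLabel where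
  system := system
  nonterminals := ⟨∅, ∅⟩
  start := graph (n := 3) (m := 2) ![point, stmt, point] ![(0, blank, 1), (1, blank, 2)]

end EFD

/-!
Since the grammar has no nonterminals, recognition is derivation read backwards, and termination
holds because every inverse rule deletes edges. For confluence, extended flow diagrams are encoded
as flow programs, in which every point is followed by at most one command and an exit can be reached
from every point. On these, an inverse rule either bypasses a statement whose point is entered by a
single edge, or collapses a decision whose `t`-edge leads back to its own point or to the same point
as its `f`-edge. These reductions commute. The overlaps for which this could fail, namely two
statements in a cycle and a decision with both edges back to its own point, do not occur, because no
exit could be reached from them.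
-/

/-! ### Gluing and derivation -/

namespace LGraph.Hom

variable {A B : Type} {G H J X : LGraph A B}

@[ext]
theorem ext {f g : Hom G H} (hV : ∀ v, f.onV v = g.onV v) (hE : ∀ e, f.onE e = g.onE e) :
    f = g := by
  obtain ⟨fV, fE, _, _, _, _⟩ := f
  obtain ⟨gV, gE, _, _, _, _⟩ := g
  obtain rfl : fV = gV := funext hV
  obtain rfl : fE = gE := funext hE
  rfl

theorem Injective.comp_left_cancel {g : Hom H J} (hg : g.Injective) {f f' : Hom G H}
    (h : g.comp f = g.comp f') : f = f' :=
  ext (fun v => hg.1 (congrArg (fun u : Hom G J => u.onV v) h))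
    fun e => hg.2 (congrArg (fun u : Hom G J => u.onE e) h)

theorem bijective_of_comp_eq_id {f : Hom G H} {f' : Hom H G} (h : f'.comp f = Hom.id G)
    (h' : f.comp f' = Hom.id H) : f.Bijective :=
  ⟨Function.bijective_iff_has_inverse.2 ⟨f'.onV, fun v => congrArg (fun u : Hom G G => u.onV v) h,
    fun v => congrArg (fun u : Hom H H => u.onV v) h'⟩,
   Function.bijective_iff_has_inverse.2 ⟨f'.onE, fun e => congrArg (fun u : Hom G G => u.onE e) h,
    fun e => congrArg (fun u : Hom H H => u.onE e) h'⟩⟩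

theorem Injective.exists_lift {i : Hom G X} {i' : Hom H X} (hi' : i'.Injective)
    (hV : Set.range i.onV ⊆ Set.range i'.onV) (hE : Set.range i.onE ⊆ Set.range i'.onE) :
    ∃ f : Hom G H, i'.comp f = i := by
  choose fV hfV using fun v => hV ⟨v, rfl⟩
  choose fE hfE using fun e => hE ⟨e, rfl⟩
  refine ⟨⟨fV, fE, fun e => hi'.1 ?_, fun e => hi'.1 ?_, fun e => ?_, fun v => ?_⟩, ext hfV hfE⟩
  · rw [hfV, i'.map_src, hfE, i.map_src]
  · rw [hfV, i'.map_tgt, hfE, i.map_tgt]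
  · rw [i'.map_edgeLabel, hfE, i.map_edgeLabel]
  · rw [i'.map_nodeLabel, hfV, i.map_nodeLabel]

end LGraph.Hom

section FunctionPushout

variable {κ α β γ δ : Type*} {k : κ → α} {d : κ → β} {g : α → γ} {i : β → γ}

theorem exists_desc_of_cover_of_overlap (hg : g.Injective) (hi : i.Injective)
    (cover : ∀ v, (∃ x, g x = v) ∨ ∃ y, i y = v)
    (overlap : ∀ x y, g x = i y → ∃ z, k z = x ∧ d z = y) {p : α → δ} {q : β → δ}
    (hpq : ∀ z, p (k z) = q (d z)) : ∃ f : γ → δ, (∀ x, f (g x) = p x) ∧ ∀ y, f (i y) = q y := by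
  have hv : ∀ v, ∃ w, (∀ x, g x = v → w = p x) ∧ ∀ y, i y = v → w = q y := by
    intro v
    rcases cover v with ⟨x, rfl⟩ | ⟨y, rfl⟩
    · refine ⟨p x, fun x' hx' => by rw [hg hx'], fun y hy => ?_⟩
      obtain ⟨z, rfl, rfl⟩ := overlap _ _ hy.symm
      exact hpq z
    · refine ⟨q y, fun x hx => ?_, fun y' hy' => by rw [hi hy']⟩
      obtain ⟨z, rfl, rfl⟩ := overlap _ _ hx
      exact (hpq z).symm
  choose f hfp hfq using hv
  exact ⟨f, fun x => hfp _ x rfl, fun y => hfq _ y rfl⟩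

theorem mem_range_right_iff_of_cover_of_overlap (comm : ∀ z, g (k z) = i (d z))
    (cover : ∀ v, (∃ x, g x = v) ∨ ∃ y, i y = v)
    (overlap : ∀ x y, g x = i y → ∃ z, k z = x ∧ d z = y) {v : γ} :
    v ∈ Set.range i ↔ ∀ x, g x = v → x ∈ Set.range k := by
  constructor
  · rintro ⟨y, rfl⟩ x hx
    obtain ⟨z, hz, -⟩ := overlap x y hx
    exact ⟨z, hz⟩
  · intro h
    rcases cover v with ⟨x, rfl⟩ | hy
    · obtain ⟨z, rfl⟩ := h x rfl
      exact ⟨d z, (comm z).symm⟩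
    · exact hy

theorem card_add_card_of_cover_of_overlap [Finite γ] (hk : k.Injective) (hg : g.Injective)
    (hi : i.Injective) (comm : ∀ z, g (k z) = i (d z))
    (cover : ∀ v, (∃ x, g x = v) ∨ ∃ y, i y = v)
    (overlap : ∀ x y, g x = i y → ∃ z, k z = x ∧ d z = y) :
    Nat.card γ + Nat.card κ = Nat.card α + Nat.card β := by
  have union : Set.range g ∪ Set.range i = Set.univ := Set.eq_univ_of_forall cover
  have inter : Set.range g ∩ Set.range i = Set.range (g ∘ k) := by
    ext v
    constructor
    · rintro ⟨⟨x, rfl⟩, y, hy⟩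
      obtain ⟨z, rfl, -⟩ := overlap x y hy.symm
      exact ⟨z, rfl⟩
    · rintro ⟨z, rfl⟩
      exact ⟨⟨k z, rfl⟩, d z, (comm z).symm⟩
  have h := Set.ncard_union_add_ncard_inter (Set.range g) (Set.range i)
  rwa [union, inter, Set.ncard_univ, Set.ncard_range_of_injective (hg.comp hk),
    Set.ncard_range_of_injective hg, Set.ncard_range_of_injective hi] at h

end FunctionPushout

namespace GRule

open LGraph

variable {A B : Type}

namespace IsGluing

variable {K L D D' G G' X : LGraph A B} {k : Hom K L} {d : Hom K D} {g : Hom L G} {i : Hom D G}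

theorem commV (h : IsGluing k d g i) (z : K.V) : g.onV (k.onV z) = i.onV (d.onV z) :=
  congrArg (fun f : Hom K G => f.onV z) h.comm

theorem commE (h : IsGluing k d g i) (z : K.E) : g.onE (k.onE z) = i.onE (d.onE z) :=
  congrArg (fun f : Hom K G => f.onE z) h.comm

theorem comp_iso (h : IsGluing k d g i) {f : Hom G G'} (hf : f.Bijective) :
    IsGluing k d (f.comp g) (f.comp i) where
  comm := congrArg f.comp h.comm
  inj_g := ⟨hf.1.1.comp h.inj_g.1, hf.2.1.comp h.inj_g.2⟩
  inj_i := ⟨hf.1.1.comp h.inj_i.1, hf.2.1.comp h.inj_i.2⟩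
  coverV v := by
    obtain ⟨v, rfl⟩ := hf.1.2 v
    exact (h.coverV v).imp (Exists.imp fun _ => congrArg f.onV)
      (Exists.imp fun _ => congrArg f.onV)
  coverE e := by
    obtain ⟨e, rfl⟩ := hf.2.2 e
    exact (h.coverE e).imp (Exists.imp fun _ => congrArg f.onE)
      (Exists.imp fun _ => congrArg f.onE)
  overlapV x y hxy := h.overlapV x y (hf.1.1 hxy)
  overlapE x y hxy := h.overlapE x y (hf.2.1 hxy)

theorem mem_range_onV_iff (h : IsGluing k d g i) {v : G.V} :
    v ∈ Set.range i.onV ↔ ∀ x, g.onV x = v → x ∈ Set.range k.onV :=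
  mem_range_right_iff_of_cover_of_overlap h.commV h.coverV h.overlapV

theorem mem_range_onE_iff (h : IsGluing k d g i) {e : G.E} :
    e ∈ Set.range i.onE ↔ ∀ x, g.onE x = e → x ∈ Set.range k.onE :=
  mem_range_right_iff_of_cover_of_overlap h.commE h.coverE h.overlapE

theorem exists_desc (h : IsGluing k d g i) {p : Hom L X} {q : Hom D X}
    (hpq : p.comp k = q.comp d) : ∃ f : Hom G X, f.comp g = p ∧ f.comp i = q := by
  obtain ⟨fV, hgV, hiV⟩ := exists_desc_of_cover_of_overlap h.inj_g.1 h.inj_i.1 h.coverV h.overlapV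
    (p := p.onV) (q := q.onV) fun z => congrArg (fun f : Hom K X => f.onV z) hpq
  obtain ⟨fE, hgE, hiE⟩ := exists_desc_of_cover_of_overlap h.inj_g.2 h.inj_i.2 h.coverE h.overlapE
    (p := p.onE) (q := q.onE) fun z => congrArg (fun f : Hom K X => f.onE z) hpq
  refine ⟨⟨fV, fE, fun e => ?_, fun e => ?_, fun e => ?_, fun v => ?_⟩, Hom.ext hgV hgE,
    Hom.ext hiV hiE⟩
  · rcases h.coverE e with ⟨x, rfl⟩ | ⟨y, rfl⟩
    · rw [← g.map_src, hgV, hgE, p.map_src]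
    · rw [← i.map_src, hiV, hiE, q.map_src]
  · rcases h.coverE e with ⟨x, rfl⟩ | ⟨y, rfl⟩
    · rw [← g.map_tgt, hgV, hgE, p.map_tgt]
    · rw [← i.map_tgt, hiV, hiE, q.map_tgt]
  · rcases h.coverE e with ⟨x, rfl⟩ | ⟨y, rfl⟩
    · rw [← g.map_edgeLabel, hgE, p.map_edgeLabel]
    · rw [← i.map_edgeLabel, hiE, q.map_edgeLabel]
  · rcases h.coverV v with ⟨x, rfl⟩ | ⟨y, rfl⟩
    · rw [← g.map_nodeLabel, hgV, p.map_nodeLabel]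
    · rw [← i.map_nodeLabel, hiV, q.map_nodeLabel]

theorem hom_ext (h : IsGluing k d g i) {f f' : Hom G X} (hg : f.comp g = f'.comp g)
    (hi : f.comp i = f'.comp i) : f = f' := by
  ext v
  · rcases h.coverV v with ⟨x, rfl⟩ | ⟨y, rfl⟩
    · exact congrArg (fun u : Hom L X => u.onV x) hg
    · exact congrArg (fun u : Hom D X => u.onV y) hi
  · rcases h.coverE v with ⟨x, rfl⟩ | ⟨y, rfl⟩
    · exact congrArg (fun u : Hom L X => u.onE x) hg
    · exact congrArg (fun u : Hom D X => u.onE y) hi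

theorem exists_complement_hom {d' : Hom K D'} {i' : Hom D' G} (h : IsGluing k d g i)
    (h' : IsGluing k d' g i') : ∃ f : Hom D D', i'.comp f = i ∧ f.comp d = d' := by
  obtain ⟨f, hf⟩ := h'.inj_i.exists_lift (i := i)
    (fun v hv => h'.mem_range_onV_iff.2 (h.mem_range_onV_iff.1 hv))
    fun e he => h'.mem_range_onE_iff.2 (h.mem_range_onE_iff.1 he)
  refine ⟨f, hf, h'.inj_i.comp_left_cancel ?_⟩
  calc i'.comp (f.comp d) = i.comp d := congrArg (fun u : Hom D G => u.comp d) hf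
    _ = i'.comp d' := h.comm.symm.trans h'.comm

end IsGluing

/-- `H` results from applying the rule `r` to `G` at the match `g`. -/
def DerivesAt (r : GRule A B) {G : LGraph A B} (g : Hom r.L G) (H : LGraph A B) : Prop :=
  ∃ (D : LGraph A B) (d : Hom r.K D) (h : Hom r.R H) (i : Hom D G) (j : Hom D H),
    IsGluing r.left d g i ∧ IsGluing r.right d h j

/-- The dangling condition: an edge outside the match touches no node that is to be deleted. -/
def Dangling (r : GRule A B) {G : LGraph A B} (g : Hom r.L G) : Prop :=
  ∀ e ∉ Set.range g.onE, ∀ x, g.onV x = G.src e ∨ g.onV x = G.tgt e → x ∈ Set.range r.left.onV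

variable {r : GRule A B} {G G' H H' : LGraph A B}

theorem directDerives_iff_exists_derivesAt :
    r.DirectDerives G H ↔ ∃ g : Hom r.L G, r.DerivesAt g H :=
  ⟨fun ⟨D, g, d, h, i, j, hg, hh⟩ => ⟨g, D, d, h, i, j, hg, hh⟩,
    fun ⟨g, D, d, h, i, j, hg, hh⟩ => ⟨D, g, d, h, i, j, hg, hh⟩⟩

namespace DerivesAt

variable {g : Hom r.L G}

theorem dangling (h : r.DerivesAt g H) : r.Dangling g := by
  obtain ⟨D, d, h, i, j, hg, -⟩ := h
  intro e he x hx
  obtain ⟨y, rfl⟩ : ∃ y, i.onE y = e := (hg.coverE e).resolve_left he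
  rw [← i.map_src, ← i.map_tgt] at hx
  exact hx.elim (hg.mem_range_onV_iff.1 ⟨_, rfl⟩ x) (hg.mem_range_onV_iff.1 ⟨_, rfl⟩ x)

theorem iso (h : r.DerivesAt g H) (h' : r.DerivesAt g H') : Iso H H' := by
  obtain ⟨D, d, h, i, j, hg, hh⟩ := h
  obtain ⟨D', d', h', i', j', hg', hh'⟩ := h'
  obtain ⟨f, hfi, hfd⟩ := hg.exists_complement_hom hg'
  obtain ⟨f', hfi', hfd'⟩ := hg'.exists_complement_hom hg
  have hff : f'.comp f = Hom.id D := hg.inj_i.comp_left_cancel <|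
    calc i.comp (f'.comp f) = i'.comp f := congrArg (fun u : Hom D' G => u.comp f) hfi'
      _ = i.comp (Hom.id D) := hfi
  have hff' : f.comp f' = Hom.id D' := hg'.inj_i.comp_left_cancel <|
    calc i'.comp (f.comp f') = i.comp f' := congrArg (fun u : Hom D G => u.comp f') hfi
      _ = i'.comp (Hom.id D') := hfi'
  obtain ⟨u, huh, huj⟩ := hh.exists_desc (p := h') (q := j'.comp f)
    (hh'.comm.trans (congrArg j'.comp hfd.symm))
  obtain ⟨w, hwh, hwj⟩ := hh'.exists_desc (p := h) (q := j.comp f')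
    (hh.comm.trans (congrArg j.comp hfd'.symm))
  refine ⟨u, Hom.bijective_of_comp_eq_id (f' := w) (hh.hom_ext ?_ ?_) (hh'.hom_ext ?_ ?_)⟩
  · calc w.comp (u.comp h) = w.comp h' := congrArg w.comp huh
      _ = h := hwh
  · calc w.comp (u.comp j) = w.comp (j'.comp f) := congrArg w.comp huj
      _ = (j.comp f').comp f := congrArg (fun v : Hom D' H => v.comp f) hwj
      _ = j := congrArg j.comp hff
  · calc u.comp (w.comp h') = u.comp h := congrArg u.comp hwh
      _ = h' := huh
  · calc u.comp (w.comp j') = u.comp (j.comp f') := congrArg u.comp hwj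
      _ = (j'.comp f).comp f' := congrArg (fun v : Hom D H' => v.comp f') huj
      _ = j' := congrArg j'.comp hff'

end DerivesAt

namespace DirectDerives

theorem symm (h : r.DirectDerives G H) : r.inv.DirectDerives H G := by
  obtain ⟨D, g, d, h, i, j, hg, hh⟩ := h
  exact ⟨D, h, d, g, j, i, hh, hg⟩

theorem congr_left (h : r.DirectDerives G H) (hG : Iso G G') : r.DirectDerives G' H := by
  obtain ⟨D, g, d, h, i, j, hg, hh⟩ := h
  obtain ⟨f, hf⟩ := hG
  exact ⟨D, f.comp g, d, h, f.comp i, j, hg.comp_iso hf, hh⟩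

theorem congr_right (h : r.DirectDerives G H) (hH : Iso H H') : r.DirectDerives G H' :=
  (h.symm.congr_left hH).symm

theorem card_edges (h : r.DirectDerives G H) :
    Nat.card G.E + Nat.card r.R.E = Nat.card H.E + Nat.card r.L.E := by
  obtain ⟨D, g, d, h, i, j, hg, hh⟩ := h
  have := G.finE
  have := H.finE
  have hG := card_add_card_of_cover_of_overlap r.left_inj.2 hg.inj_g.2 hg.inj_i.2 hg.commE
    hg.coverE hg.overlapE
  have hH := card_add_card_of_cover_of_overlap r.right_inj.2 hh.inj_g.2 hh.inj_i.2 hh.commE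
    hh.coverE hh.overlapE
  omega

end DirectDerives

end GRule

namespace GTSystem

open LGraph

variable {A B : Type} {T : GTSystem A B} {G G' H H' : LGraph A B}

theorem Step.congr_left (h : T.Step G H) (hG : Iso G G') : T.Step G' H := by
  obtain ⟨r, hr, h⟩ := h
  exact ⟨r, hr, h.congr_left hG⟩

theorem Step.congr_right (h : T.Step G H) (hH : Iso H H') : T.Step G H' := by
  obtain ⟨r, hr, h⟩ := h
  exact ⟨r, hr, h.congr_right hH⟩

theorem step_inverse_iff : T.inverse.Step G H ↔ T.Step H G := by
  constructor
  · rintro ⟨_, ⟨r, hr, rfl⟩, h⟩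
    exact ⟨r, hr, h.symm⟩
  · rintro ⟨r, hr, h⟩
    exact ⟨r.inv, ⟨r, hr, rfl⟩, h.symm⟩

theorem derives_inverse_iff : T.inverse.Derives G H ↔ T.Derives H G := by
  have swap_step : T.inverse.Step = Function.swap T.Step := by
    ext G H
    exact step_inverse_iff
  rw [Derives, swap_step, Relation.transGen_swap]
  exact or_congr_left ⟨iso_symm, iso_symm⟩

namespace Derives

theorem congr_right (h : T.Derives G H) (hH : Iso H H') : T.Derives G H' := by
  rcases h with h | h
  · exact Or.inl (iso_trans h hH)
  · right
    cases h with
    | single h => exact .single (h.congr_right hH)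
    | tail h h' => exact .tail h (h'.congr_right hH)

theorem congr_left (h : T.Derives G H) (hG : Iso G G') : T.Derives G' H :=
  derives_inverse_iff.1 ((derives_inverse_iff.2 h).congr_right hG)

theorem tail (h : T.Derives G H) (h' : T.Step H H') : T.Derives G H' := by
  rcases h with h | h
  · exact Or.inr (.single (h'.congr_left (iso_symm h)))
  · exact Or.inr (.tail h h')

theorem preserves {P : LGraph A B → Prop} (hiso : ∀ G H, P G → Iso G H → P H)
    (hstep : ∀ G H, P G → T.Step G H → P H) (h : T.Derives G H) (hG : P G) : P H := by
  rcases h with h | h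
  · exact hiso _ _ hG h
  · induction h with
    | single h => exact hstep _ _ hG h
    | tail _ h ih => exact hstep _ _ ih h

end Derives

theorem terminating_of_card_edges_lt (hT : ∀ r ∈ T.rules, Nat.card r.R.E < Nat.card r.L.E) :
    T.Terminating := by
  rintro ⟨G, hG⟩
  refine not_strictAnti_of_wellFoundedLT (fun n => Nat.card (G n).E)
    (strictAnti_nat_of_succ_lt fun n => ?_)
  obtain ⟨r, hr, h⟩ := hG n
  have := h.card_edges
  have := hT r hr
  omega

theorem confluentOn_of_simulation {D : Set (AbstractGraph A B)} {X : Type*} {red : X → X → Prop}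
    (γ : X → LGraph A B)
    (diamond : ∀ x y z, red x y → red x z → y = z ∨ ∃ w, red y w ∧ red z w)
    (represented : ∀ G : LGraph A B, G.cls ∈ D → ∃ x, Iso G (γ x))
    (step_of_red : ∀ x y, red x y → T.Step (γ x) (γ y))
    (red_of_step : ∀ x G H, Iso G (γ x) → T.Step G H → ∃ y, red x y ∧ Iso H (γ y)) :
    T.ConfluentOn D := by
  have derives_of_red : ∀ {x y}, Relation.ReflTransGen red x y → T.Derives (γ x) (γ y) := by
    intro x y h
    induction h with
    | refl => exact Or.inl (iso_refl _)
    | tail _ h ih => exact ih.tail (step_of_red _ _ h)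
  have red_of_derives : ∀ {x G H}, Iso G (γ x) → T.Derives G H →
      ∃ y, Relation.ReflTransGen red x y ∧ Iso H (γ y) := by
    intro x G H hG h
    refine h.preserves (P := fun H => ∃ y, Relation.ReflTransGen red x y ∧ Iso H (γ y)) ?_ ?_
      ⟨x, .refl, hG⟩
    · rintro G H ⟨y, hy, hG⟩ hGH
      exact ⟨y, hy, iso_trans (iso_symm hGH) hG⟩
    · rintro G H ⟨y, hy, hG⟩ hGH
      obtain ⟨z, hz, hH⟩ := red_of_step y G H hG hGH
      exact ⟨z, hy.tail hz, hH⟩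
  intro G H₁ H₂ hGD h₁ h₂
  obtain ⟨x, hG⟩ := represented G hGD
  obtain ⟨y₁, hy₁, hH₁⟩ := red_of_derives hG h₁
  obtain ⟨y₂, hy₂, hH₂⟩ := red_of_derives hG h₂
  obtain ⟨z, hz₁, hz₂⟩ : Relation.Join (Relation.ReflTransGen red) y₁ y₂ := by
    refine Relation.church_rosser (fun a b c hab hac => ?_) hy₁ hy₂
    rcases diamond a b c hab hac with rfl | ⟨w, hbw, hcw⟩
    · exact ⟨b, .refl, .refl⟩
    · exact ⟨w, .single hbw, .single hcw⟩
  exact ⟨γ z, (derives_of_red hz₁).congr_left (iso_symm hH₁),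
    (derives_of_red hz₂).congr_left (iso_symm hH₂)⟩

end GTSystem

namespace GraphGrammar

open LGraph

variable {A B : Type} {𝒢 : GraphGrammar A B}

theorem cls_mem_language_iff (h : 𝒢.nonterminals = ⟨∅, ∅⟩) {G : LGraph A B} :
    G.cls ∈ 𝒢.language ↔ 𝒢.system.Derives 𝒢.start G := by
  constructor
  · rintro ⟨G', hG', -, hG⟩
    exact hG'.congr_right (iso_symm (Quotient.exact hG))
  · intro hG
    refine ⟨G, hG, ⟨fun v => ?_, fun e => ?_⟩, rfl⟩ <;> simp [terminals, h]

theorem recognises_inverse (h : 𝒢.nonterminals = ⟨∅, ∅⟩) :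
    𝒢.system.inverse.Recognises 𝒢.terminals 𝒢.language :=
  ⟨𝒢.start, (cls_mem_language_iff h).2 (Or.inl (iso_refl _)), fun _ _ =>
    (cls_mem_language_iff h).trans GTSystem.derives_inverse_iff.symm⟩

end GraphGrammar

/-! ### Rewriting graphs with named nodes and edges -/

/-- A finite graph whose nodes and edges are sets of names from the types `ν` and `ε`. Two graphs
over the same names can be compared by equalities of sets, so that no isomorphisms intervene when
one arises from the other by a rewrite step. The functions have junk values outside the sets. -/
structure NamedGraph (ν ε A B : Type) where
  nodes : Set ν
  edges : Set ε
  src : ε → ν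
  tgt : ε → ν
  nodeLabel : ν → A
  edgeLabel : ε → B
  finite_nodes : nodes.Finite
  finite_edges : edges.Finite
  src_mem : ∀ e ∈ edges, src e ∈ nodes
  tgt_mem : ∀ e ∈ edges, tgt e ∈ nodes

namespace NamedGraph

open LGraph

variable {ν ε A B : Type} {D N N' : NamedGraph ν ε A B}

/-- The graph with the given named nodes and edges. -/
def graph (N : NamedGraph ν ε A B) : LGraph A B where
  V := N.nodes
  E := N.edges
  finV := N.finite_nodes
  finE := N.finite_edges
  src := fun e => ⟨N.src e, N.src_mem e e.2⟩
  tgt := fun e => ⟨N.tgt e, N.tgt_mem e e.2⟩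
  nodeLabel := fun v => N.nodeLabel v
  edgeLabel := fun e => N.edgeLabel e

/-- The names of the nodes in the image of a morphism. -/
def nodeImage {L : LGraph A B} (g : Hom L N.graph) : Set ν := Set.range fun x => (g.onV x).1

/-- The names of the edges in the image of a morphism. -/
def edgeImage {L : LGraph A B} (g : Hom L N.graph) : Set ε := Set.range fun e => (g.onE e).1

section Names

variable {L : LGraph A B} (g : Hom L N.graph)

theorem src_onE (e : L.E) : N.src (g.onE e).1 = (g.onV (L.src e)).1 :=
  (congrArg Subtype.val (g.map_src e)).symm

theorem tgt_onE (e : L.E) : N.tgt (g.onE e).1 = (g.onV (L.tgt e)).1 :=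
  (congrArg Subtype.val (g.map_tgt e)).symm

theorem nodeLabel_onV (x : L.V) : N.nodeLabel (g.onV x).1 = L.nodeLabel x :=
  (g.map_nodeLabel x).symm

theorem edgeLabel_onE (e : L.E) : N.edgeLabel (g.onE e).1 = L.edgeLabel e :=
  (g.map_edgeLabel e).symm

end Names

/-- `D` is a subgraph of `N`, with the same names. -/
structure IsSubgraph (D N : NamedGraph ν ε A B) : Prop where
  nodes_subset : D.nodes ⊆ N.nodes
  edges_subset : D.edges ⊆ N.edges
  src_eq : ∀ e ∈ D.edges, D.src e = N.src e
  tgt_eq : ∀ e ∈ D.edges, D.tgt e = N.tgt e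
  nodeLabel_eq : ∀ x ∈ D.nodes, D.nodeLabel x = N.nodeLabel x
  edgeLabel_eq : ∀ e ∈ D.edges, D.edgeLabel e = N.edgeLabel e

namespace IsSubgraph

/-- The inclusion morphism of a subgraph. -/
def inclusion (h : D.IsSubgraph N) : Hom D.graph N.graph where
  onV := fun x => ⟨x.1, h.nodes_subset x.2⟩
  onE := fun e => ⟨e.1, h.edges_subset e.2⟩
  map_src := fun e => Subtype.ext (h.src_eq e.1 e.2)
  map_tgt := fun e => Subtype.ext (h.tgt_eq e.1 e.2)
  map_edgeLabel := fun e => h.edgeLabel_eq e.1 e.2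
  map_nodeLabel := fun x => h.nodeLabel_eq x.1 x.2

theorem inclusion_injective (h : D.IsSubgraph N) : h.inclusion.Injective :=
  ⟨fun _ _ hxy => Subtype.ext (congrArg Subtype.val hxy :),
    fun _ _ hxy => Subtype.ext (congrArg Subtype.val hxy :)⟩

theorem isGluing (h : D.IsSubgraph N) {K L : LGraph A B} {k : Hom K L} {d : Hom K D.graph}
    {g : Hom L N.graph} (hg : g.Injective) (comm : g.comp k = h.inclusion.comp d)
    (nodes_eq : D.nodes = N.nodes \ nodeImage g ∪ nodeImage d)
    (edges_eq : D.edges = N.edges \ edgeImage g ∪ edgeImage d) :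
    GRule.IsGluing k d g h.inclusion where
  comm := comm
  inj_g := hg
  inj_i := h.inclusion_injective
  coverV v := by
    refine or_iff_not_imp_left.2 fun hv => ⟨⟨v.1, ?_⟩, rfl⟩
    rw [nodes_eq]
    exact Or.inl ⟨v.2, fun ⟨x, hx⟩ => hv ⟨x, Subtype.ext hx⟩⟩
  coverE e := by
    refine or_iff_not_imp_left.2 fun he => ⟨⟨e.1, ?_⟩, rfl⟩
    rw [edges_eq]
    exact Or.inl ⟨e.2, fun ⟨x, hx⟩ => he ⟨x, Subtype.ext hx⟩⟩
  overlapV x y hxy := by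
    obtain hy | ⟨z, hz⟩ : y.1 ∈ N.nodes \ nodeImage g ∪ nodeImage d := nodes_eq ▸ y.2
    · exact absurd ⟨x, congrArg Subtype.val hxy⟩ hy.2
    · obtain rfl : d.onV z = y := Subtype.ext hz
      exact ⟨z, hg.1 ((congrArg (fun u : Hom K N.graph => u.onV z) comm).trans hxy.symm), rfl⟩
  overlapE x y hxy := by
    obtain hy | ⟨z, hz⟩ : y.1 ∈ N.edges \ edgeImage g ∪ edgeImage d := edges_eq ▸ y.2
    · exact absurd ⟨x, congrArg Subtype.val hxy⟩ hy.2
    · obtain rfl : d.onE z = y := Subtype.ext hz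
      exact ⟨z, hg.2 ((congrArg (fun u : Hom K N.graph => u.onE z) comm).trans hxy.symm), rfl⟩

end IsSubgraph

theorem iso_graph_of_surjective {L : LGraph A B} {g : Hom L N.graph} (hg : g.Injective)
    (hV : N.nodes ⊆ nodeImage g) (hE : N.edges ⊆ edgeImage g) : Iso L N.graph :=
  ⟨g, ⟨hg.1, fun v => (hV v.2).imp fun _ => Subtype.ext⟩,
    ⟨hg.2, fun e => (hE e.2).imp fun _ => Subtype.ext⟩⟩

variable {r : GRule A B}

/-- The names of the nodes that the application of a rule at a match deletes. -/
def deletedNodes (g : Hom r.L N.graph) : Set ν :=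
  (fun x => (g.onV x).1) '' (Set.range r.left.onV)ᶜ

theorem dangling_iff {g : Hom r.L N.graph} : r.Dangling g ↔
    ∀ e ∈ N.edges, N.src e ∈ deletedNodes g ∨ N.tgt e ∈ deletedNodes g → e ∈ edgeImage g := by
  constructor
  · intro hd e he h
    by_contra hge
    have outside : (⟨e, he⟩ : N.graph.E) ∉ Set.range g.onE := fun ⟨y, hy⟩ =>
      hge ⟨y, congrArg Subtype.val hy⟩
    rcases h with ⟨x, hx, hxe⟩ | ⟨x, hx, hxe⟩
    · exact hx (hd _ outside x (Or.inl (Subtype.ext hxe)))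
    · exact hx (hd _ outside x (Or.inr (Subtype.ext hxe)))
  · intro h e he x hxe
    by_contra hx
    obtain ⟨y, hy⟩ := h e.1 e.2 <| hxe.imp (fun hxe => ⟨x, hx, congrArg Subtype.val hxe⟩)
      fun hxe => ⟨x, hx, congrArg Subtype.val hxe⟩
    exact he ⟨y, Subtype.ext hy⟩

variable {g : Hom r.L N.graph} {h : Hom r.R N'.graph}

/-- The part of `N` that remains when the image of `L ∖ K` is deleted. -/
def context (g : Hom r.L N.graph) (hd : r.Dangling g) : NamedGraph ν ε A B where
  nodes := N.nodes \ nodeImage g ∪ nodeImage (g.comp r.left)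
  edges := N.edges \ edgeImage g ∪ edgeImage (g.comp r.left)
  src := N.src
  tgt := N.tgt
  nodeLabel := N.nodeLabel
  edgeLabel := N.edgeLabel
  finite_nodes := (N.finite_nodes.sdiff).union (have := r.K.finV; Set.finite_range _)
  finite_edges := (N.finite_edges.sdiff).union (have := r.K.finE; Set.finite_range _)
  src_mem := by
    rintro e (⟨he, heg⟩ | ⟨z, rfl⟩)
    · by_cases hx : N.src e ∈ nodeImage g
      · obtain ⟨x, hx⟩ := hx
        obtain ⟨z, rfl⟩ := hd ⟨e, he⟩ (fun ⟨y, hy⟩ => heg ⟨y, congrArg Subtype.val hy⟩) x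
          (Or.inl (Subtype.ext hx))
        exact Or.inr ⟨z, hx⟩
      · exact Or.inl ⟨N.src_mem e he, hx⟩
    · exact Or.inr ⟨r.K.src z, congrArg Subtype.val ((g.comp r.left).map_src z)⟩
  tgt_mem := by
    rintro e (⟨he, heg⟩ | ⟨z, rfl⟩)
    · by_cases hx : N.tgt e ∈ nodeImage g
      · obtain ⟨x, hx⟩ := hx
        obtain ⟨z, rfl⟩ := hd ⟨e, he⟩ (fun ⟨y, hy⟩ => heg ⟨y, congrArg Subtype.val hy⟩) x
          (Or.inr (Subtype.ext hx))
        exact Or.inr ⟨z, hx⟩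
      · exact Or.inl ⟨N.tgt_mem e he, hx⟩
    · exact Or.inr ⟨r.K.tgt z, congrArg Subtype.val ((g.comp r.left).map_tgt z)⟩

theorem context_isSubgraph (hd : r.Dangling g) : (context g hd).IsSubgraph N where
  nodes_subset := Set.union_subset Set.sdiff_subset fun _ ⟨z, hz⟩ =>
    hz ▸ ((g.comp r.left).onV z).2
  edges_subset := Set.union_subset Set.sdiff_subset fun _ ⟨z, hz⟩ =>
    hz ▸ ((g.comp r.left).onE z).2
  src_eq _ _ := rfl
  tgt_eq _ _ := rfl
  nodeLabel_eq _ _ := rfl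
  edgeLabel_eq _ _ := rfl

/-- The morphism from the interface of a rule into the context of a match. -/
def interfaceHom (hd : r.Dangling g) : Hom r.K (context g hd).graph where
  onV := fun z => ⟨_, Or.inr ⟨z, rfl⟩⟩
  onE := fun z => ⟨_, Or.inr ⟨z, rfl⟩⟩
  map_src := fun z => Subtype.ext (congrArg Subtype.val ((g.comp r.left).map_src z) :)
  map_tgt := fun z => Subtype.ext (congrArg Subtype.val ((g.comp r.left).map_tgt z) :)
  map_edgeLabel := (g.comp r.left).map_edgeLabel
  map_nodeLabel := (g.comp r.left).map_nodeLabel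

/-- Replacing the image of `g` in `N` by the image of `h` yields `N'`: the two images share the
interface, and `N` and `N'` agree outside them. -/
structure IsRewrite (r : GRule A B) (g : Hom r.L N.graph) (h : Hom r.R N'.graph) : Prop where
  interfaceV : ∀ z, (g.onV (r.left.onV z)).1 = (h.onV (r.right.onV z)).1
  interfaceE : ∀ z, (g.onE (r.left.onE z)).1 = (h.onE (r.right.onE z)).1
  nodes_eq : N.nodes \ nodeImage g = N'.nodes \ nodeImage h
  edges_eq : N.edges \ edgeImage g = N'.edges \ edgeImage h
  src_eq : ∀ e ∈ N.edges \ edgeImage g, N.src e = N'.src e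
  tgt_eq : ∀ e ∈ N.edges \ edgeImage g, N.tgt e = N'.tgt e
  nodeLabel_eq : ∀ x ∈ N.nodes \ nodeImage g, N.nodeLabel x = N'.nodeLabel x
  edgeLabel_eq : ∀ e ∈ N.edges \ edgeImage g, N.edgeLabel e = N'.edgeLabel e

namespace IsRewrite

theorem symm (H : IsRewrite r g h) : IsRewrite r.inv h g where
  interfaceV z := (H.interfaceV z).symm
  interfaceE z := (H.interfaceE z).symm
  nodes_eq := H.nodes_eq.symm
  edges_eq := H.edges_eq.symm
  src_eq e he := (H.src_eq e (H.edges_eq ▸ he)).symm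
  tgt_eq e he := (H.tgt_eq e (H.edges_eq ▸ he)).symm
  nodeLabel_eq x hx := (H.nodeLabel_eq x (H.nodes_eq ▸ hx)).symm
  edgeLabel_eq e he := (H.edgeLabel_eq e (H.edges_eq ▸ he)).symm

theorem nodeImage_comp_eq (H : IsRewrite r g h) :
    nodeImage (g.comp r.left) = nodeImage (h.comp r.right) :=
  congrArg Set.range (funext H.interfaceV)

theorem edgeImage_comp_eq (H : IsRewrite r g h) :
    edgeImage (g.comp r.left) = edgeImage (h.comp r.right) :=
  congrArg Set.range (funext H.interfaceE)

theorem context_isSubgraph (H : IsRewrite r g h) (hd : r.Dangling g) :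
    (context g hd).IsSubgraph N' where
  nodes_subset := Set.union_subset (H.nodes_eq ▸ Set.sdiff_subset) <|
    H.nodeImage_comp_eq ▸ fun _ ⟨z, hz⟩ => hz ▸ ((h.comp r.right).onV z).2
  edges_subset := Set.union_subset (H.edges_eq ▸ Set.sdiff_subset) <|
    H.edgeImage_comp_eq ▸ fun _ ⟨z, hz⟩ => hz ▸ ((h.comp r.right).onE z).2
  src_eq := by
    rintro e (he | ⟨z, rfl⟩)
    · exact H.src_eq e he
    · calc N.src (g.onE (r.left.onE z)).1 = (g.onV (r.left.onV (r.K.src z))).1 :=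
            (congrArg Subtype.val ((g.comp r.left).map_src z)).symm
        _ = (h.onV (r.right.onV (r.K.src z))).1 := H.interfaceV _
        _ = N'.src (h.onE (r.right.onE z)).1 :=
            congrArg Subtype.val ((h.comp r.right).map_src z)
        _ = N'.src (g.onE (r.left.onE z)).1 := by rw [H.interfaceE]
  tgt_eq := by
    rintro e (he | ⟨z, rfl⟩)
    · exact H.tgt_eq e he
    · calc N.tgt (g.onE (r.left.onE z)).1 = (g.onV (r.left.onV (r.K.tgt z))).1 :=
            (congrArg Subtype.val ((g.comp r.left).map_tgt z)).symm
        _ = (h.onV (r.right.onV (r.K.tgt z))).1 := H.interfaceV _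
        _ = N'.tgt (h.onE (r.right.onE z)).1 :=
            congrArg Subtype.val ((h.comp r.right).map_tgt z)
        _ = N'.tgt (g.onE (r.left.onE z)).1 := by rw [H.interfaceE]
  nodeLabel_eq := by
    rintro x (hx | ⟨z, rfl⟩)
    · exact H.nodeLabel_eq x hx
    · calc N.nodeLabel (g.onV (r.left.onV z)).1 = N'.nodeLabel (h.onV (r.right.onV z)).1 :=
            ((g.comp r.left).map_nodeLabel z).symm.trans ((h.comp r.right).map_nodeLabel z)
        _ = N'.nodeLabel (g.onV (r.left.onV z)).1 := by rw [H.interfaceV]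
  edgeLabel_eq := by
    rintro e (he | ⟨z, rfl⟩)
    · exact H.edgeLabel_eq e he
    · calc N.edgeLabel (g.onE (r.left.onE z)).1 = N'.edgeLabel (h.onE (r.right.onE z)).1 :=
            ((g.comp r.left).map_edgeLabel z).symm.trans ((h.comp r.right).map_edgeLabel z)
        _ = N'.edgeLabel (g.onE (r.left.onE z)).1 := by rw [H.interfaceE]

theorem derivesAt (H : IsRewrite r g h) (hg : g.Injective) (hh : h.Injective)
    (hd : r.Dangling g) : r.DerivesAt g N'.graph := by
  refine ⟨_, interfaceHom hd, h, (NamedGraph.context_isSubgraph hd).inclusion,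
    (H.context_isSubgraph hd).inclusion,
    (NamedGraph.context_isSubgraph hd).isGluing hg rfl rfl rfl,
    (H.context_isSubgraph hd).isGluing hh ?_ ?_ ?_⟩
  · exact Hom.ext (fun z => Subtype.ext (H.interfaceV z).symm)
      fun z => Subtype.ext (H.interfaceE z).symm
  · exact congrArg (· ∪ _) H.nodes_eq
  · exact congrArg (· ∪ _) H.edges_eq

end IsRewrite

end NamedGraph

/-! ### Flow programs and their reduction -/

namespace EFD

open EdgeLabel

/-- What follows a program point that bears a given name: there is no such point, or it is an exit,
or it is followed by a statement, or by a decision with a `t`-successor and an `f`-successor. -/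
inductive Instr (α : Type*)
  | absent
  | exit
  | stmt (b : α)
  | dec (b c : α)

namespace Instr

variable {α : Type*}

/-- The successor along the edge with a given label. -/
def next : Instr α → EdgeLabel → Option α
  | stmt b, blank => some b
  | dec b _, t => some b
  | dec _ c, f => some c
  | _, _ => none

/-- Rename the successors. -/
def map (σ : α → α) : Instr α → Instr α
  | absent => absent
  | exit => exit
  | stmt b => stmt (σ b)
  | dec b c => dec (σ b) (σ c)

/-- Replace the successor along the edge with a given label, if there is one. -/
def setNext : Instr α → EdgeLabel → α → Instr α
  | stmt _, blank, b' => stmt b'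
  | dec _ c, t, b' => dec b' c
  | dec b _, f, c' => dec b c'
  | i, _, _ => i

theorem next_map (σ : α → α) (i : Instr α) (l : EdgeLabel) :
    (i.map σ).next l = (i.next l).map σ := by
  cases i <;> cases l <;> rfl

@[simp]
theorem next_absent (l : EdgeLabel) : (absent : Instr α).next l = none := by cases l <;> rfl

@[simp]
theorem next_exit (l : EdgeLabel) : (exit : Instr α).next l = none := by cases l <;> rfl

@[simp]
theorem next_stmt {b c : α} {l : EdgeLabel} :
    (stmt b).next l = some c ↔ l = blank ∧ b = c := by
  cases l <;> simp [next]

@[simp]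
theorem next_dec {b c d : α} {l : EdgeLabel} :
    (dec b c).next l = some d ↔ l = t ∧ b = d ∨ l = f ∧ c = d := by
  cases l <;> simp [next]

theorem map_eq_absent_iff {σ : α → α} {i : Instr α} : i.map σ = absent ↔ i = absent := by
  cases i <;> simp [map]

theorem map_eq_exit_iff {σ : α → α} {i : Instr α} : i.map σ = exit ↔ i = exit := by
  cases i <;> simp [map]

theorem map_map (σ τ : α → α) (i : Instr α) : (i.map σ).map τ = i.map fun x => τ (σ x) := by
  cases i <;> rfl

theorem map_eq_self {σ : α → α} {i : Instr α} (h : ∀ l x, i.next l = some x → σ x = x) :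
    i.map σ = i := by
  cases i with
  | absent => rfl
  | exit => rfl
  | stmt b => exact congrArg stmt (h blank b rfl)
  | dec b c => exact congrArg₂ dec (h t b rfl) (h f c rfl)

theorem next_setNext {i : Instr α} {l m : EdgeLabel} {b c x : α} (h : i.next l = some c) :
    (i.setNext l b).next m = some x ↔ m = l ∧ x = b ∨ m ≠ l ∧ i.next m = some x := by
  cases i <;> cases l <;> cases m <;> simp_all [setNext, next, eq_comm]

theorem map_setNext {i : Instr α} {l : EdgeLabel} {b c : α} {σ : α → α} (h : i.next l = some c)
    (hb : σ b = c) (hσ : ∀ m x, i.next m = some x → σ x = x) : (i.setNext l b).map σ = i := by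
  cases i with
  | absent => simp at h
  | exit => simp at h
  | stmt x => cases l <;> simp_all [setNext, map, next]
  | dec x y =>
    have hx := hσ t x rfl
    have hy := hσ f y rfl
    cases l <;> simp_all [setNext, map, next]

end Instr

open Instr

/-- A flow program with points named by elements of `α`; every point is followed by at most one
command, so that a command is named by the point before it. -/
abbrev Prog (α : Type*) := α → Instr α

namespace Prog

variable {α : Type*} {s s₁ s₂ : Prog α} {a b c d z x y : α} {l m : EdgeLabel}

/-- An exit can be reached from a point. -/
inductive Halts (s : Prog α) : α → Prop
  | exit {a : α} (h : s a = exit) : Halts s a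
  | step {a b : α} {l : EdgeLabel} (h : (s a).next l = some b) (hb : Halts s b) : Halts s a

/-- The flow programs that arise from extended flow diagrams: there are finitely many points, and an
exit can be reached from each of them. Only the points with a predecessor are mentioned, since the
other ones are exits or have a successor. -/
structure WellFormed (s : Prog α) : Prop where
  finite : {a | s a ≠ absent}.Finite
  halts_of_next : ∀ a l b, (s a).next l = some b → Halts s b

/-- The edge labelled `l` from the command at `a` is the only one into the point `b`. -/
structure OnlyRef (s : Prog α) (b a : α) (l : EdgeLabel) : Prop where
  next_eq : (s a).next l = some b
  unique : ∀ a' l', (s a').next l' = some b → a' = a ∧ l' = l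

theorem Halts.ne_absent (h : Halts s a) : s a ≠ absent := by
  cases h with
  | exit h => simp [h]
  | step h _ =>
    intro ha
    simp [ha] at h

theorem Halts.ne_dec_self (h : Halts s a) : s a ≠ dec a a := by
  induction h <;> grind [next_dec]

theorem Halts.not_stmt_cycle (h : Halts s a) (hab : s a = stmt b) : s b ≠ stmt a := by
  induction h generalizing b <;> grind [next_stmt]

namespace WellFormed

theorem ne_absent_of_next (hs : WellFormed s) (h : (s a).next l = some b) : s b ≠ absent :=
  (hs.halts_of_next a l b h).ne_absent

theorem not_stmt_cycle (hs : WellFormed s) (hab : s a = stmt b) : s b ≠ stmt a := fun hba =>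
  (hs.halts_of_next a blank b (by simp [hab])).not_stmt_cycle hba hab

theorem ne_of_stmt (hs : WellFormed s) (hab : s a = stmt b) : a ≠ b := by
  rintro rfl
  exact hs.not_stmt_cycle hab hab

theorem ne_of_dec (hs : WellFormed s) (ha : s a = dec z c) (hz : z = a ∨ z = c) : a ≠ c := by
  rintro rfl
  obtain rfl : z = a := hz.elim id id
  exact (hs.halts_of_next z t z (by simp [ha])).ne_dec_self ha

end WellFormed

theorem OnlyRef.ne (hs : WellFormed s) (hb : s b = stmt d) (h : OnlyRef s b a l) : a ≠ b := by
  rintro rfl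
  exact hs.ne_of_stmt hb (next_stmt.1 (hb ▸ h.next_eq)).2.symm

section Collapse

variable [DecidableEq α]

/-- Replace the command at `a` by a statement with successor `c`. -/
def collapse (s : Prog α) (a c : α) : Prog α := Function.update s a (stmt c)

@[simp]
theorem collapse_self : collapse s a c a = stmt c := Function.update_self ..

theorem collapse_of_ne (h : x ≠ a) : collapse s a c x = s x := Function.update_of_ne h ..

theorem collapse_comm (h : a ≠ b) :
    collapse (collapse s a c) b d = collapse (collapse s b d) a c := Function.update_comm h ..

theorem halts_collapse_iff (ha : s a = dec z c) (hz : z = a ∨ z = c) :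
    Halts (collapse s a c) x ↔ Halts s x := by
  constructor
  · intro h
    induction h with
    | @exit x h => exact .exit (by grind [collapse_self, collapse_of_ne])
    | @step x y l h _ ih =>
      by_cases hx : x = a
      · obtain ⟨-, rfl⟩ : l = blank ∧ c = y := by simpa [hx] using h
        exact .step (l := f) (by simp [hx, ha]) ih
      · exact .step (by rw [← h, collapse_of_ne hx]) ih
  · intro h
    induction h with
    | @exit x h => exact .exit (by grind [collapse_of_ne])
    | @step x y l h _ ih =>
      by_cases hx : x = a
      · have : y = a ∨ y = c := by grind [next_dec]
        rcases this with rfl | rfl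
        · exact hx ▸ ih
        · exact .step (l := blank) (by simp [hx]) ih
      · exact .step (by rw [collapse_of_ne hx, h]) ih

theorem wellFormed_collapse_iff (ha : s a = dec z c) (hz : z = a ∨ z = c) :
    WellFormed (collapse s a c) ↔ WellFormed s := by
  have points_eq : {x | collapse s a c x ≠ absent} = {x | s x ≠ absent} := by
    ext x
    grind [collapse_self, collapse_of_ne]
  refine ⟨fun ⟨hfin, h⟩ => ⟨points_eq ▸ hfin, fun x l y hy => ?_⟩,
    fun ⟨hfin, h⟩ => ⟨points_eq ▸ hfin, fun x l y hy => ?_⟩⟩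
  · have hc := h a blank c (by simp)
    have hx := h x l y
    simp only [halts_collapse_iff ha hz] at hc hx
    by_cases hxa : x = a
    · have halts_a : Halts s a := .step (l := f) (by simp [ha]) hc
      have : y = a ∨ y = c := by grind [next_dec]
      rcases this with rfl | rfl <;> assumption
    · exact hx (by rw [collapse_of_ne hxa, hy])
  · rw [halts_collapse_iff ha hz]
    by_cases hxa : x = a
    · obtain ⟨-, rfl⟩ : l = blank ∧ c = y := by simpa [hxa] using hy
      exact h a f c (by simp [ha])
    · exact h x l y (by rw [← hy, collapse_of_ne hxa])

end Collapse

section Bypass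

variable [DecidableEq α]

/-- Send `b` to `d`, and every other point to itself. -/
def redirect (b d x : α) : α := if x = b then d else x

/-- Delete the point `b` and redirect the edges into it to `d`. -/
def bypass (s : Prog α) (b d : α) : Prog α := fun x =>
  if x = b then absent else (s x).map (redirect b d)

@[simp]
theorem bypass_self : bypass s b d b = absent := if_pos rfl

theorem bypass_of_ne (h : x ≠ b) : bypass s b d x = (s x).map (redirect b d) := if_neg h

theorem next_bypass_eq_some_iff :
    (bypass s b d x).next l = some y ↔
      x ≠ b ∧ ∃ y', (s x).next l = some y' ∧ redirect b d y' = y := by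
  by_cases hx : x = b
  · simp [hx]
  · simp [bypass_of_ne hx, next_map, hx]

theorem bypass_ne_absent_iff : bypass s b d x ≠ absent ↔ x ≠ b ∧ s x ≠ absent := by
  by_cases hx : x = b
  · simp [hx]
  · simp [bypass_of_ne hx, map_eq_absent_iff, hx]

theorem halts_of_halts_bypass (hb : s b = stmt d) (h : Halts (bypass s b d) x) : Halts s x := by
  induction h with
  | @exit x h => exact .exit (by grind [bypass, map_eq_exit_iff])
  | @step x y l h _ ih =>
    obtain ⟨-, y', hy', rfl⟩ := next_bypass_eq_some_iff.1 h
    by_cases hy : y' = b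
    · have hd : Halts s d := by simpa [redirect, hy] using ih
      exact .step hy' (hy ▸ .step (l := blank) (by simp [hb]) hd)
    · exact .step hy' (by simpa [redirect, hy] using ih)

theorem halts_bypass_redirect (hb : s b = stmt d) (h : Halts s x) :
    Halts (bypass s b d) (redirect b d x) := by
  induction h with
  | @exit x h =>
    have hx : x ≠ b := by grind
    simpa only [redirect, hx, if_false] using .exit (by rw [bypass_of_ne hx, h, map])
  | @step x y l h _ ih =>
    by_cases hx : x = b
    · obtain ⟨-, rfl⟩ : l = blank ∧ d = y := by simpa [hx, hb] using h
      simpa [redirect, hx] using ih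
    · have := Halts.step (next_bypass_eq_some_iff.2 ⟨hx, y, h, rfl⟩) ih
      simpa only [redirect, hx, if_false] using this

theorem WellFormed.bypass (hs : WellFormed s) (hb : s b = stmt d) : WellFormed (bypass s b d) where
  finite := hs.finite.subset fun _ hx => (bypass_ne_absent_iff.1 hx).2
  halts_of_next x l y h := by
    obtain ⟨-, y', hy', rfl⟩ := next_bypass_eq_some_iff.1 h
    exact halts_bypass_redirect hb (hs.halts_of_next x l y' hy')

theorem WellFormed.of_bypass (hs : WellFormed (Prog.bypass s b d)) (hb : s b = stmt d)
    (hd : Halts s d) : WellFormed s where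
  finite := (hs.finite.insert b).subset fun x hx =>
    or_iff_not_imp_left.2 fun hxb => bypass_ne_absent_iff.2 ⟨hxb, hx⟩
  halts_of_next x l y h := by
    by_cases hy : y = b
    · exact .step (l := blank) (by simp [hy, hb]) hd
    by_cases hx : x = b
    · obtain ⟨-, rfl⟩ : l = blank ∧ d = y := by simpa [hx, hb] using h
      exact hd
    · refine halts_of_halts_bypass hb (hs.halts_of_next x l y ?_)
      exact next_bypass_eq_some_iff.2 ⟨hx, y, h, if_neg hy⟩

theorem OnlyRef.next_bypass (hs : WellFormed s) (hb : s b = stmt d) (h : OnlyRef s b a l) :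
    (Prog.bypass s b d a).next l = some d :=
  next_bypass_eq_some_iff.2 ⟨h.ne hs hb, b, h.next_eq, if_pos rfl⟩

theorem OnlyRef.bypass {b' a' : α} {l' : EdgeLabel} (hs : WellFormed s) (hb : s b = stmt d)
    (h : OnlyRef s b a l) (h' : OnlyRef s b' a' l') (hne : b ≠ b') :
    ∃ a'' l'', OnlyRef (Prog.bypass s b d) b' a'' l'' := by
  by_cases hd : d = b'
  · subst hd
    refine ⟨a, l, h.next_bypass hs hb, fun x m hx => ?_⟩
    obtain ⟨hxb, y, hy, hyd⟩ := next_bypass_eq_some_iff.1 hx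
    have hbd := h'.unique b blank (by simp [hb])
    have := h.unique x m
    have := h'.unique x m
    grind [redirect]
  · have ha' : a' ≠ b := by
      rintro rfl
      exact hd (next_stmt.1 (hb ▸ h'.next_eq)).2
    refine ⟨a', l', next_bypass_eq_some_iff.2 ⟨ha', b', h'.next_eq, if_neg hne.symm⟩,
      fun x m hx => ?_⟩
    obtain ⟨-, y, hy, hyd⟩ := next_bypass_eq_some_iff.1 hx
    have := h'.unique x m
    grind [redirect]

theorem bypass_comm {b' d' : α} (hs : WellFormed s) (hb : s b = stmt d) (hb' : s b' = stmt d')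
    (hne : b ≠ b') :
    bypass (bypass s b d) b' (redirect b d d') = bypass (bypass s b' d') b (redirect b' d' d) := by
  have redirect_comm : (fun x => redirect b' (redirect b d d') (redirect b d x)) =
      fun x => redirect b (redirect b' d' d) (redirect b' d' x) := by
    have := hs.not_stmt_cycle hb
    funext x
    grind [redirect]
  funext x
  grind [bypass, map_map, map]

theorem collapse_bypass {a' c' : α} (hne : a' ≠ b) :
    collapse (bypass s b d) a' (redirect b d c') = bypass (collapse s a' c') b d := by
  funext x
  by_cases hxa : x = a'
  · rw [hxa, collapse_self, bypass_of_ne hne, collapse_self, map]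
  rw [collapse_of_ne hxa]
  by_cases hxb : x = b
  · rw [hxb, bypass_self, bypass_self]
  · rw [bypass_of_ne hxb, bypass_of_ne hxb, collapse_of_ne hxa]

/-- Insert a statement at the fresh point `b` into the edge labelled `l` from the command at `a`
to the point `d`. -/
def subdivide (s : Prog α) (a : α) (l : EdgeLabel) (b d : α) : Prog α :=
  Function.update (Function.update s a ((s a).setNext l b)) b (stmt d)

theorem subdivide_self : subdivide s a l b d b = stmt d := Function.update_self ..

theorem next_subdivide (hb : s b = absent) (h : (s a).next l = some d) :
    (subdivide s a l b d x).next m = some y ↔ x = b ∧ m = blank ∧ y = d ∨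
      x = a ∧ m = l ∧ y = b ∨ (x ≠ a ∨ m ≠ l) ∧ (s x).next m = some y := by
  have hab : a ≠ b := by
    rintro rfl
    simp [hb] at h
  by_cases hxb : x = b
  · subst hxb
    simp [subdivide_self, hb, hab.symm, eq_comm (a := y), eq_comm (a := m)]
  by_cases hxa : x = a
  · subst hxa
    simp [subdivide, hxb, next_setNext h]
  · simp [subdivide, hxa, hxb]

theorem onlyRef_subdivide (hs : WellFormed s) (hb : s b = absent) (h : (s a).next l = some d) :
    OnlyRef (subdivide s a l b d) b a l := by
  have fresh : ∀ x m, (s x).next m ≠ some b := fun x m hx => hs.ne_absent_of_next hx hb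
  refine ⟨(next_subdivide hb h).2 (by simp), fun x m hx => ?_⟩
  grind [next_subdivide]

theorem bypass_subdivide (hs : WellFormed s) (hb : s b = absent) (h : (s a).next l = some d) :
    bypass (subdivide s a l b d) b d = s := by
  have redirect_eq : ∀ x m y, (s x).next m = some y → redirect b d y = y := fun x m y hy =>
    if_neg fun hyb => hs.ne_absent_of_next hy (by rw [hyb, hb])
  funext x
  by_cases hxb : x = b
  · rw [hxb, bypass_self, hb]
  rw [bypass_of_ne hxb, subdivide, Function.update_of_ne hxb]
  by_cases hxa : x = a
  · rw [hxa, Function.update_self]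
    exact map_setNext h (if_pos rfl) (redirect_eq a)
  · rw [Function.update_of_ne hxa]
    exact map_eq_self (redirect_eq x)

theorem WellFormed.subdivide (hs : WellFormed s) (hb : s b = absent) (h : (s a).next l = some d) :
    WellFormed (subdivide s a l b d) := by
  have bypass_eq := bypass_subdivide hs hb h
  have hd := hs.halts_of_next a l d h
  exact of_bypass (bypass_eq.symm ▸ hs) subdivide_self
    (halts_of_halts_bypass subdivide_self (bypass_eq.symm ▸ hd))

end Bypass

section Reduction

variable [DecidableEq α]

/-- The effect of the inverse grammar rules on flow programs: bypass a statement whose point is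
entered by a single edge, or collapse a decision whose `t`-edge leads back to its own point or to
the same point as its `f`-edge. -/
inductive Red (s : Prog α) : Prog α → Prop
  | bypass {b d a : α} {l : EdgeLabel} (hb : s b = stmt d) (h : OnlyRef s b a l) :
      Red s (bypass s b d)
  | collapse {a z c : α} (ha : s a = dec z c) (hz : z = a ∨ z = c) : Red s (collapse s a c)

namespace Red

theorem wellFormed (hs : WellFormed s) (h : Red s s₁) : WellFormed s₁ := by
  cases h with
  | bypass hb _ => exact hs.bypass hb
  | collapse ha hz => exact (wellFormed_collapse_iff ha hz).2 hs

theorem bypass_bypass {b' d' a' : α} {l' : EdgeLabel} (hs : WellFormed s) (hb : s b = stmt d)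
    (h : OnlyRef s b a l) (hb' : s b' = stmt d') (h' : OnlyRef s b' a' l') (hne : b ≠ b') :
    Red (Prog.bypass s b d) (Prog.bypass (Prog.bypass s b d) b' (redirect b d d')) := by
  obtain ⟨a'', l'', h''⟩ := h.bypass hs hb h' hne
  exact .bypass (by rw [bypass_of_ne hne.symm, hb', map]) h''

theorem exists_bypass_collapse {a' : α} (hb : s b = stmt d) (h : OnlyRef s b a l)
    (ha' : s a' = dec z c) (hz : z = a' ∨ z = c) :
    ∃ s₃, Red (Prog.bypass s b d) s₃ ∧ Red (Prog.collapse s a' c) s₃ := by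
  have hne : a' ≠ b := by grind
  have htb := h.unique a' t
  have hfb := h.unique a' f
  have hzb : z ≠ b := by grind [next_dec]
  refine ⟨Prog.collapse (Prog.bypass s b d) a' (redirect b d c), .collapse (z := z) ?_ ?_, ?_⟩
  · rw [bypass_of_ne hne, ha', map, redirect, if_neg hzb]
  · grind [redirect]
  · rw [collapse_bypass hne]
    have hb' : Prog.collapse s a' c b = stmt d := by rw [collapse_of_ne hne.symm, hb]
    by_cases hc : c = b
    · refine .bypass (a := a') (l := blank) hb' ⟨by simp [hc], fun x m hx => ?_⟩
      by_cases hxa : x = a'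
      · exact ⟨hxa, (by simpa [hxa] using hx : m = blank ∧ c = b).1⟩
      · have hxa' := h.unique x m (by rw [← hx, collapse_of_ne hxa])
        exact absurd (hxa'.1.trans (hfb (by simp [ha', hc])).1.symm) hxa
    · have haa : a ≠ a' := by
        have := h.next_eq
        grind [next_dec]
      refine .bypass (a := a) (l := l) hb' ⟨by rw [collapse_of_ne haa, h.next_eq], fun x m hx => ?_⟩
      by_cases hxa : x = a'
      · exact absurd (by simpa [hxa] using hx : m = blank ∧ c = b).2 hc
      · exact h.unique x m (by rw [← hx, collapse_of_ne hxa])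

theorem diamond (hs : WellFormed s) (h₁ : Red s s₁) (h₂ : Red s s₂) :
    s₁ = s₂ ∨ ∃ s₃, Red s₁ s₃ ∧ Red s₂ s₃ := by
  cases h₁ with
  | @bypass b d a l hb h =>
    cases h₂ with
    | @bypass b' d' a' l' hb' h' =>
      by_cases hne : b = b'
      · left
        grind
      · refine Or.inr ⟨_, bypass_bypass hs hb h hb' h' hne, ?_⟩
        rw [bypass_comm hs hb hb' hne]
        exact bypass_bypass hs hb' h' hb h (Ne.symm hne)
    | @collapse a' z c ha' hz => exact Or.inr (exists_bypass_collapse hb h ha' hz)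
  | @collapse a z c ha hz =>
    cases h₂ with
    | @bypass b d a' l hb h =>
      obtain ⟨s₃, h₁, h₂⟩ := exists_bypass_collapse hb h ha hz
      exact Or.inr ⟨s₃, h₂, h₁⟩
    | @collapse a' z' c' ha' hz' =>
      by_cases hne : a = a'
      · left
        grind
      · refine Or.inr ⟨Prog.collapse (Prog.collapse s a c) a' c', ?_, ?_⟩
        · exact .collapse (by rw [collapse_of_ne (Ne.symm hne), ha']) hz'
        · rw [collapse_comm hne]
          exact .collapse (by rw [collapse_of_ne hne, ha]) hz

end Red

end Reduction

end Prog

/-! ### Diagrams of flow programs -/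

open LGraph

/-- The label of the command that follows a point; the junk value `point` means that there is
none. -/
def Instr.label {α : Type*} : Instr α → NodeLabel
  | absent => .point
  | exit => .point
  | stmt _ => .stmt
  | dec _ _ => .decision

instance : Finite EdgeLabel :=
  .of_surjective ![t, f, blank] fun l => by
    cases l
    exacts [⟨0, rfl⟩, ⟨1, rfl⟩, ⟨2, rfl⟩]

namespace Instr

variable {α : Type*} {i : Instr α} {b c : α} {l : EdgeLabel}

theorem label_map (σ : α → α) (i : Instr α) : (i.map σ).label = i.label := by
  cases i <;> rfl

@[simp] theorem label_stmt : (stmt b).label = .stmt := rfl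

@[simp] theorem label_dec : (dec b c).label = .decision := rfl

theorem label_ne_point_of_next (h : i.next l = some b) : i.label ≠ .point := by
  cases i <;> simp_all [label]

theorem next_blank_eq_some_iff : i.next blank = some b ↔ i = stmt b := by
  cases i <;> simp [next]

theorem label_eq_decision_of_next (h : i.next l = some b) (hl : l ≠ blank) :
    i.label = .decision := by
  cases i <;> simp_all

theorem label_eq_decision_iff : i.label = .decision ↔ ∃ b c, i = dec b c := by
  cases i <;> simp [label]

end Instr

/-- The nodes of the diagram of a flow program: the points and the commands that follow them. -/
inductive NodeName (α : Type)
  | pt (a : α)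
  | cmd (a : α)

/-- The edges of the diagram of a flow program: from a point into the command that follows it, and
out of this command. -/
inductive EdgeName (α : Type)
  | into (a : α)
  | out (a : α) (l : EdgeLabel)

open NodeName EdgeName

namespace Prog

variable {α : Type} {s : Prog α} {a b c d : α} {l : EdgeLabel}

theorem ne_absent_of_label (h : (s a).label ≠ .point) : s a ≠ absent := fun ha =>
  h (by rw [ha, label])

theorem WellFormed.finite_setOf_label (hs : WellFormed s) : {a | (s a).label ≠ .point}.Finite :=
  hs.finite.subset fun _ => ne_absent_of_label

theorem WellFormed.finite_setOf_next (hs : WellFormed s) :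
    {p : α × EdgeLabel | ∃ b, (s p.1).next p.2 = some b}.Finite :=
  (hs.finite_setOf_label.prod Set.finite_univ).subset fun _ ⟨_, hb⟩ =>
    ⟨label_ne_point_of_next hb, Set.mem_univ _⟩

/-- The extended flow diagram of a flow program. The default value of `Option.getD` is never
used. -/
def WellFormed.net (hs : WellFormed s) :
    NamedGraph (NodeName α) (EdgeName α) NodeLabel EdgeLabel where
  nodes := pt '' {a | s a ≠ absent} ∪ cmd '' {a | (s a).label ≠ .point}
  edges := into '' {a | (s a).label ≠ .point} ∪
    (fun p => out p.1 p.2) '' {p : α × EdgeLabel | ∃ b, (s p.1).next p.2 = some b}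
  src
    | into a => pt a
    | out a _ => cmd a
  tgt
    | into a => cmd a
    | out a l => pt (((s a).next l).getD a)
  nodeLabel
    | pt _ => .point
    | cmd a => (s a).label
  edgeLabel
    | into _ => blank
    | out _ l => l
  finite_nodes := (hs.finite.image pt).union (hs.finite_setOf_label.image cmd)
  finite_edges := (hs.finite_setOf_label.image into).union (hs.finite_setOf_next.image _)
  src_mem := by
    rintro _ (⟨a, ha, rfl⟩ | ⟨⟨a, l⟩, ⟨b, hb⟩, rfl⟩)
    · exact .inl ⟨a, ne_absent_of_label ha, rfl⟩
    · exact .inr ⟨a, label_ne_point_of_next hb, rfl⟩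
  tgt_mem := by
    rintro _ (⟨a, ha, rfl⟩ | ⟨⟨a, l⟩, ⟨b, hb⟩, rfl⟩)
    · exact .inr ⟨a, ha, rfl⟩
    · exact .inl ⟨b, hs.ne_absent_of_next hb, by simp [hb]⟩

section Net

variable (hs : WellFormed s)

@[simp] theorem pt_mem_nodes : pt a ∈ hs.net.nodes ↔ s a ≠ absent := by simp [WellFormed.net]

@[simp] theorem cmd_mem_nodes : cmd a ∈ hs.net.nodes ↔ (s a).label ≠ .point := by
  simp [WellFormed.net]

@[simp] theorem into_mem_edges : into a ∈ hs.net.edges ↔ (s a).label ≠ .point := by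
  simp [WellFormed.net]

@[simp] theorem out_mem_edges : out a l ∈ hs.net.edges ↔ ∃ b, (s a).next l = some b := by
  simp [WellFormed.net]

@[simp] theorem src_into : hs.net.src (into a) = pt a := rfl

@[simp] theorem src_out : hs.net.src (out a l) = cmd a := rfl

@[simp] theorem tgt_into : hs.net.tgt (into a) = cmd a := rfl

@[simp] theorem nodeLabel_pt : hs.net.nodeLabel (pt a) = .point := rfl

@[simp] theorem nodeLabel_cmd : hs.net.nodeLabel (cmd a) = (s a).label := rfl

@[simp] theorem edgeLabel_into : hs.net.edgeLabel (into a) = blank := rfl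

@[simp] theorem edgeLabel_out : hs.net.edgeLabel (out a l) = l := rfl

theorem tgt_out (h : (s a).next l = some b) : hs.net.tgt (out a l) = pt b := by
  simp [WellFormed.net, h]

variable {hs}

section Hom

variable {L : LGraph NodeLabel EdgeLabel} (g : Hom L hs.net.graph)

theorem exists_onV_eq_pt {x : L.V} (h : L.nodeLabel x = .point) : ∃ a, (g.onV x).1 = pt a := by
  have hx := (g.onV x).2
  have hl := (NamedGraph.nodeLabel_onV g x).trans h
  cases hgx : (g.onV x).1 with
  | pt a => exact ⟨a, rfl⟩
  | cmd a =>
    rw [hgx] at hl hx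
    exact absurd hl ((cmd_mem_nodes hs).1 hx)

theorem exists_onV_eq_cmd {x : L.V} (h : L.nodeLabel x ≠ .point) : ∃ a, (g.onV x).1 = cmd a := by
  have hl := NamedGraph.nodeLabel_onV g x
  cases hgx : (g.onV x).1 with
  | pt a =>
    rw [hgx] at hl
    exact absurd hl.symm h
  | cmd a => exact ⟨a, rfl⟩

theorem label_of_onV {x : L.V} (h : (g.onV x).1 = cmd a) : (s a).label = L.nodeLabel x := by
  rw [← NamedGraph.nodeLabel_onV g x, h, nodeLabel_cmd]

theorem onE_of_src_pt {e : L.E} (h : (g.onV (L.src e)).1 = pt a) :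
    (g.onE e).1 = into a ∧ (g.onV (L.tgt e)).1 = cmd a := by
  have hsrc := (NamedGraph.src_onE g e).trans h
  have htgt := NamedGraph.tgt_onE g e
  cases hge : (g.onE e).1 with
  | into b =>
    rw [hge] at hsrc htgt
    obtain rfl : b = a := pt.inj hsrc
    exact ⟨rfl, htgt.symm⟩
  | out b l =>
    rw [hge] at hsrc
    cases hsrc

theorem onE_of_src_cmd {e : L.E} (h : (g.onV (L.src e)).1 = cmd a) :
    ∃ b, (s a).next (L.edgeLabel e) = some b ∧ (g.onE e).1 = out a (L.edgeLabel e) ∧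
      (g.onV (L.tgt e)).1 = pt b := by
  have hsrc := (NamedGraph.src_onE g e).trans h
  have htgt := NamedGraph.tgt_onE g e
  have hlab := NamedGraph.edgeLabel_onE g e
  have hmem := (g.onE e).2
  cases hge : (g.onE e).1 with
  | into b =>
    rw [hge] at hsrc
    cases hsrc
  | out b l =>
    rw [hge] at hsrc htgt hlab hmem
    obtain rfl : b = a := cmd.inj hsrc
    obtain rfl : l = L.edgeLabel e := hlab
    obtain ⟨c, hc⟩ := (out_mem_edges hs).1 hmem
    exact ⟨c, hc, rfl, htgt.symm.trans (tgt_out hs hc)⟩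

end Hom

end Net

end Prog

/-- The morphism into a named graph with given images of the nodes and edges. -/
def namedHom {ν ε : Type} {n m : ℕ} {lab : Fin n → NodeLabel}
    {edge : Fin m → Fin n × EdgeLabel × Fin n} (N : NamedGraph ν ε NodeLabel EdgeLabel)
    (v : Fin n → ν) (e : Fin m → ε) (hv : ∀ i, v i ∈ N.nodes ∧ N.nodeLabel (v i) = lab i)
    (he : ∀ j, e j ∈ N.edges ∧ N.src (e j) = v (edge j).1 ∧ N.tgt (e j) = v (edge j).2.2 ∧
      N.edgeLabel (e j) = (edge j).2.1) : Hom (graph lab edge) N.graph where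
  onV := fun i => ⟨v i, (hv i).1⟩
  onE := fun j => ⟨e j, (he j).1⟩
  map_src := fun j => Subtype.ext (he j).2.1.symm
  map_tgt := fun j => Subtype.ext (he j).2.2.1.symm
  map_edgeLabel := fun j => (he j).2.2.2.symm
  map_nodeLabel := fun i => (hv i).2.symm

section NamedHom

variable {ν ε : Type} {n m : ℕ} {lab : Fin n → NodeLabel} {edge : Fin m → Fin n × EdgeLabel × Fin n}
  {N : NamedGraph ν ε NodeLabel EdgeLabel} {g g' : Hom (graph lab edge) N.graph}

theorem injective_of_nodup (hV : (List.ofFn fun i => (g.onV i).1).Nodup)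
    (hE : (List.ofFn fun j => (g.onE j).1).Nodup) : g.Injective :=
  ⟨(List.nodup_ofFn.1 hV).of_comp, (List.nodup_ofFn.1 hE).of_comp⟩

theorem eq_of_names_eq (hV : ∀ i : Fin n, (g.onV i).1 = (g'.onV i).1)
    (hE : ∀ j : Fin m, (g.onE j).1 = (g'.onE j).1) : g = g' :=
  Hom.ext (fun i => Subtype.ext (hV i)) fun j => Subtype.ext (hE j)

end NamedHom

/-- The graph `• → □ → •`: the start graph, and the left-hand side of the rules for statements. -/
abbrev stmtGraph : LGraph NodeLabel EdgeLabel :=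
  graph (n := 3) (m := 2) ![.point, .stmt, .point] ![(0, blank, 1), (1, blank, 2)]

/-- The common form of `whileLoop` and `ddec`: the `t`-edge of the decision leads to the `z`-th of
the two interface nodes. -/
def decisionRule (z : Fin 2) : GRule NodeLabel EdgeLabel :=
  rule (n := 3) (m := 2) (n' := 3) (m' := 3) (k := 2)
    ![.point, .stmt, .point] ![(0, blank, 1), (1, blank, 2)]
    ![.point, .decision, .point] ![(0, blank, 1), (1, t, ![0, 2] z), (1, f, 2)]
    ![0, 2] ![0, 2] (by decide) (by decide) (by decide)

/-- The common form of `dec1` and `dec2`: a statement is inserted into the edge labelled `l` of a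
decision. -/
def branchRule (l : EdgeLabel) : GRule NodeLabel EdgeLabel :=
  rule (n := 2) (m := 1) (n' := 4) (m' := 3) (k := 2)
    ![.decision, .point] ![(0, l, 1)]
    ![.decision, .point, .point, .stmt] ![(0, l, 2), (2, blank, 3), (3, blank, 1)]
    ![0, 1] ![0, 1] (by decide) (by decide) (by decide)

theorem mem_rules_iff {r : GRule NodeLabel EdgeLabel} : r ∈ system.rules ↔
    r = seq ∨ (∃ z, r = decisionRule z) ∨ ∃ l ≠ blank, r = branchRule l := by
  have decision : (∃ z, r = decisionRule z) ↔ r = whileLoop ∨ r = ddec := Fin.exists_fin_two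
  have branch : (∃ l ≠ blank, r = branchRule l) ↔ r = dec1 ∨ r = dec2 := by
    refine ⟨fun ⟨l, hl, h⟩ => ?_, ?_⟩
    · cases l
      exacts [.inl h, .inr h, absurd rfl hl]
    · rintro (h | h)
      exacts [⟨t, by simp, h⟩, ⟨f, by simp, h⟩]
  simp only [decision, branch, system, Set.mem_insert_iff, Set.mem_singleton_iff, or_assoc]

section Occurrence

variable {α : Type} {s : Prog α} {a b c d : α} {l : EdgeLabel} {z : Fin 2} (hs : s.WellFormed)

/-- The occurrence of `• → □ → •` at the point `a`. -/
def stmtHom (ha : s a = stmt b) : Hom stmtGraph hs.net.graph :=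
  have hab : (s a).next blank = some b := next_blank_eq_some_iff.2 ha
  namedHom hs.net ![pt a, cmd a, pt b] ![into a, out a blank]
    (by simp [Fin.forall_fin_succ, ha, hs.ne_absent_of_next hab])
    (by simp [Fin.forall_fin_succ, ha, Prog.tgt_out hs hab])

/-- The occurrence of `• → □ → • → □ → •` at the points `a` and `b`. -/
def seqHom (ha : s a = stmt b) (hb : s b = stmt d) : Hom seq.R hs.net.graph :=
  have hab : (s a).next blank = some b := next_blank_eq_some_iff.2 ha
  have hbd : (s b).next blank = some d := next_blank_eq_some_iff.2 hb
  namedHom hs.net ![pt a, cmd a, pt d, pt b, cmd b] ![into a, out a blank, into b, out b blank]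
    (by simp [Fin.forall_fin_succ, ha, hb, hs.ne_absent_of_next hbd])
    (by simp [Fin.forall_fin_succ, ha, hb, Prog.tgt_out hs hab, Prog.tgt_out hs hbd])

/-- The occurrence of the right-hand side of `decisionRule z` at the point `a`. -/
def decisionHom (ha : s a = dec (![a, c] z) c) : Hom (decisionRule z).R hs.net.graph :=
  have hat : (s a).next t = some (![a, c] z) := by simp [ha]
  have haf : (s a).next f = some c := by simp [ha]
  have pt_eq : pt (![a, c] z) = ![pt a, cmd a, pt c] (![0, 2] z) := by fin_cases z <;> rfl
  namedHom hs.net ![pt a, cmd a, pt c] ![into a, out a t, out a f]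
    (by simp [Fin.forall_fin_succ, ha, hs.ne_absent_of_next haf])
    (by simp [Fin.forall_fin_succ, ha, Prog.tgt_out hs hat, Prog.tgt_out hs haf, pt_eq])

/-- The occurrence of the left-hand side of `branchRule l` at the decision that follows `a`. -/
def branchHom (ha : (s a).label = .decision) (hl : (s a).next l = some d) :
    Hom (branchRule l).L hs.net.graph :=
  namedHom hs.net ![cmd a, pt d] ![out a l]
    (by simp [Fin.forall_fin_succ, ha, hs.ne_absent_of_next hl])
    (by simp [hl, Prog.tgt_out hs hl])

/-- The occurrence of the right-hand side of `branchRule l` at the decision that follows `a` and the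
statement that follows `b`. -/
def longBranchHom (ha : (s a).label = .decision) (hl : (s a).next l = some b)
    (hb : s b = stmt d) : Hom (branchRule l).R hs.net.graph :=
  have hbd : (s b).next blank = some d := next_blank_eq_some_iff.2 hb
  namedHom hs.net ![cmd a, pt d, pt b, cmd b] ![out a l, into b, out b blank]
    (by simp [Fin.forall_fin_succ, ha, hb, hs.ne_absent_of_next hbd])
    (by simp [Fin.forall_fin_succ, hl, hb, Prog.tgt_out hs hl, Prog.tgt_out hs hbd])

variable {hs}

theorem stmtHom_injective {ha : s a = stmt b} : (stmtHom hs ha).Injective :=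
  injective_of_nodup (by simp [stmtHom, namedHom, hs.ne_of_stmt ha])
    (by simp [stmtHom, namedHom])

theorem seqHom_injective {ha : s a = stmt b} {hb : s b = stmt d} :
    (seqHom hs ha hb).Injective := by
  have hab := hs.ne_of_stmt ha
  have hdb := (hs.ne_of_stmt hb).symm
  have had : a ≠ d := fun h => hs.not_stmt_cycle ha (h ▸ hb)
  exact injective_of_nodup (by simp [seqHom, namedHom, hab, hdb, had])
    (by simp [seqHom, namedHom, hab])

theorem decisionHom_injective {ha : s a = dec (![a, c] z) c} :
    (decisionHom hs ha).Injective := by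
  have hac : a ≠ c := hs.ne_of_dec ha (by fin_cases z <;> simp)
  exact injective_of_nodup (by simp [decisionHom, namedHom, hac])
    (by simp [decisionHom, namedHom])

theorem branchHom_injective {ha : (s a).label = .decision} {hl : (s a).next l = some d} :
    (branchHom hs ha hl).Injective :=
  injective_of_nodup (by simp [branchHom, namedHom]) (by simp [branchHom, namedHom])

theorem longBranchHom_injective {ha : (s a).label = .decision} {hl : (s a).next l = some b}
    {hb : s b = stmt d} : (longBranchHom hs ha hl hb).Injective := by
  have hab : a ≠ b := by
    rintro rfl
    simp [hb] at ha
  have hdb := (hs.ne_of_stmt hb).symm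
  exact injective_of_nodup (by simp [longBranchHom, namedHom, hab, hdb])
    (by simp [longBranchHom, namedHom, hab])

theorem exists_eq_stmtHom (g : Hom stmtGraph hs.net.graph) :
    ∃ a b, ∃ ha : s a = stmt b, g = stmtHom hs ha := by
  obtain ⟨a, v0⟩ := Prog.exists_onV_eq_pt g (x := (0 : Fin 3)) rfl
  obtain ⟨e0, v1⟩ := Prog.onE_of_src_pt g (e := (0 : Fin 2)) v0
  obtain ⟨b, hb, e1, v2⟩ := Prog.onE_of_src_cmd g (e := (1 : Fin 2)) v1
  refine ⟨a, b, next_blank_eq_some_iff.1 hb, eq_of_names_eq ?_ ?_⟩ <;> intro i <;> fin_cases i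
  exacts [v0, v1, v2, e0, e1]

theorem exists_eq_seqHom (g : Hom seq.R hs.net.graph) :
    ∃ a b d, ∃ (ha : s a = stmt b) (hb : s b = stmt d), g = seqHom hs ha hb := by
  obtain ⟨a, v0⟩ := Prog.exists_onV_eq_pt g (x := (0 : Fin 5)) rfl
  obtain ⟨e0, v1⟩ := Prog.onE_of_src_pt g (e := (0 : Fin 4)) v0
  obtain ⟨b, hb, e1, v3⟩ := Prog.onE_of_src_cmd g (e := (1 : Fin 4)) v1
  obtain ⟨e2, v4⟩ := Prog.onE_of_src_pt g (e := (2 : Fin 4)) v3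
  obtain ⟨d, hd, e3, v2⟩ := Prog.onE_of_src_cmd g (e := (3 : Fin 4)) v4
  refine ⟨a, b, d, next_blank_eq_some_iff.1 hb, next_blank_eq_some_iff.1 hd,
    eq_of_names_eq ?_ ?_⟩ <;> intro i <;> fin_cases i
  exacts [v0, v1, v2, v3, v4, e0, e1, e2, e3]

theorem exists_eq_decisionHom (g : Hom (decisionRule z).R hs.net.graph) :
    ∃ a c, ∃ ha : s a = dec (![a, c] z) c, g = decisionHom hs ha := by
  obtain ⟨a, v0⟩ := Prog.exists_onV_eq_pt g (x := (0 : Fin 3)) rfl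
  obtain ⟨e0, v1⟩ := Prog.onE_of_src_pt g (e := (0 : Fin 3)) v0
  obtain ⟨y, hy, e1, vz⟩ := Prog.onE_of_src_cmd g (e := (1 : Fin 3)) v1
  obtain ⟨c, hc, e2, v2⟩ := Prog.onE_of_src_cmd g (e := (2 : Fin 3)) v1
  have hyz : y = ![a, c] z := by
    fin_cases z
    exacts [pt.inj (vz.symm.trans v0), pt.inj (vz.symm.trans v2)]
  have ha : s a = dec (![a, c] z) c := by
    obtain ⟨y', c', ha⟩ := label_eq_decision_iff.1 (Prog.label_of_onV g v1)
    rw [ha] at hy hc ⊢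
    exact congrArg₂ dec ((Option.some.inj hy).trans hyz) (Option.some.inj hc)
  refine ⟨a, c, ha, eq_of_names_eq ?_ ?_⟩ <;> intro i <;> fin_cases i
  exacts [v0, v1, v2, e0, e1, e2]

theorem exists_eq_branchHom (g : Hom (branchRule l).L hs.net.graph) :
    ∃ a d, ∃ (ha : (s a).label = .decision) (hl : (s a).next l = some d),
      g = branchHom hs ha hl := by
  obtain ⟨a, v0⟩ := Prog.exists_onV_eq_cmd g (x := (0 : Fin 2)) nofun
  obtain ⟨d, hd, e0, v1⟩ := Prog.onE_of_src_cmd g (e := (0 : Fin 1)) v0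
  refine ⟨a, d, Prog.label_of_onV g v0, hd, eq_of_names_eq ?_ ?_⟩ <;> intro i <;> fin_cases i
  exacts [v0, v1, e0]

theorem exists_eq_longBranchHom (g : Hom (branchRule l).R hs.net.graph) :
    ∃ a b d, ∃ (ha : (s a).label = .decision) (hl : (s a).next l = some b) (hb : s b = stmt d),
      g = longBranchHom hs ha hl hb := by
  obtain ⟨a, v0⟩ := Prog.exists_onV_eq_cmd g (x := (0 : Fin 4)) nofun
  obtain ⟨b, hb, e0, v2⟩ := Prog.onE_of_src_cmd g (e := (0 : Fin 3)) v0
  obtain ⟨e1, v3⟩ := Prog.onE_of_src_pt g (e := (1 : Fin 3)) v2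
  obtain ⟨d, hd, e2, v1⟩ := Prog.onE_of_src_cmd g (e := (2 : Fin 3)) v3
  refine ⟨a, b, d, Prog.label_of_onV g v0, hb, next_blank_eq_some_iff.1 hd,
    eq_of_names_eq ?_ ?_⟩ <;> intro i <;> fin_cases i
  exacts [v0, v1, v2, v3, e0, e1, e2]

end Occurrence

namespace Prog

variable {α : Type} [DecidableEq α] {s : Prog α} {a b c d x z : α} {l : EdgeLabel}

section Bypass

theorem label_bypass (h : x ≠ b) : (bypass s b d x).label = (s x).label := by
  rw [bypass_of_ne h, label_map]

theorem nodes_bypass (hs : WellFormed s) (hb : s b = stmt d) :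
    (hs.bypass hb).net.nodes = hs.net.nodes \ {pt b, cmd b} := by
  ext x
  cases x with
  | pt y => simp [bypass_ne_absent_iff, and_comm]
  | cmd y =>
    by_cases hy : y = b
    · simp [hy, label]
    · simp [hy, label_bypass]

theorem edges_bypass (hs : WellFormed s) (hb : s b = stmt d) :
    (hs.bypass hb).net.edges = hs.net.edges \ {into b, out b blank} := by
  ext e
  cases e with
  | into y =>
    by_cases hy : y = b
    · simp [hy, label]
    · simp [hy, label_bypass]
  | out y l =>
    by_cases hy : y = b
    · simp [hy, hb]
    · simp [hy, bypass_of_ne, next_map]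

theorem nodeLabel_bypass (hs : WellFormed s) (hb : s b = stmt d) {x : NodeName α}
    (hx : x ∈ (hs.bypass hb).net.nodes) :
    (hs.bypass hb).net.nodeLabel x = hs.net.nodeLabel x := by
  cases x with
  | pt y => rfl
  | cmd y =>
    have hy : y ≠ b := by
      rintro rfl
      simp [label] at hx
    simp [label_bypass hy]

theorem tgt_bypass (hs : WellFormed s) (hb : s b = stmt d) (h : OnlyRef s b a l) {e : EdgeName α}
    (he : e ∈ (hs.bypass hb).net.edges) (hea : e ≠ out a l) :
    (hs.bypass hb).net.tgt e = hs.net.tgt e := by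
  cases e with
  | into y => rfl
  | out y m =>
    obtain ⟨x, hx⟩ := (out_mem_edges _).1 he
    obtain ⟨hy, x', hx', rfl⟩ := next_bypass_eq_some_iff.1 hx
    have hxb : x' ≠ b := by
      rintro rfl
      obtain ⟨rfl, rfl⟩ := h.unique y m hx'
      exact hea rfl
    rw [tgt_out _ hx, tgt_out _ hx', redirect, if_neg hxb]

end Bypass

section Collapse

theorem collapse_ne_absent_iff (ha : s a = dec z c) {x : α} :
    collapse s a c x ≠ absent ↔ s x ≠ absent := by
  by_cases hx : x = a
  · simp [hx, ha]
  · rw [collapse_of_ne hx]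

theorem label_collapse_eq_point_iff (ha : s a = dec z c) {x : α} :
    (collapse s a c x).label = .point ↔ (s x).label = .point := by
  by_cases hx : x = a
  · simp [hx, ha]
  · rw [collapse_of_ne hx]

variable (hs : WellFormed s) (hs' : WellFormed (collapse s a c))

theorem nodeLabel_collapse {x : NodeName α} (hx : x ≠ cmd a) :
    hs'.net.nodeLabel x = hs.net.nodeLabel x := by
  cases x with
  | pt y => rfl
  | cmd y =>
    have hy : y ≠ a := fun h => hx (congrArg cmd h)
    simp [collapse_of_ne hy]

theorem tgt_collapse {e : EdgeName α} (he : e ∈ hs'.net.edges \ {into a, out a blank}) :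
    hs'.net.tgt e = hs.net.tgt e := by
  cases e with
  | into y => rfl
  | out y l =>
    have hy : y ≠ a := by
      rintro rfl
      simp at he
    simp [WellFormed.net, collapse_of_ne hy]

variable (ha : s a = dec z c)

include ha

theorem nodes_collapse : hs'.net.nodes = hs.net.nodes := by
  ext x
  cases x <;> simp [collapse_ne_absent_iff ha, label_collapse_eq_point_iff ha]

theorem edges_collapse :
    hs'.net.edges \ {into a, out a blank} = hs.net.edges \ {into a, out a t, out a f} := by
  ext e
  cases e with
  | into y => simp [label_collapse_eq_point_iff ha]
  | out y l =>
    by_cases hy : y = a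
    · cases l <;> simp [hy, ha]
    · simp [hy, collapse_of_ne]

end Collapse

end Prog

/-! ### Rewriting diagrams -/

open NamedGraph Prog

variable {α : Type} {s s' : Prog α} {a b c d : α} {l : EdgeLabel} {z : Fin 2}

section Images

variable (hs : s.WellFormed)

theorem nodeImage_stmtHom (ha : s a = stmt b) :
    nodeImage (stmtHom hs ha) = {pt a, cmd a, pt b} := by
  change Set.range ![pt a, cmd a, pt b] = _
  simp only [Matrix.range_cons, Matrix.range_empty, Set.union_empty, Set.singleton_union]

theorem edgeImage_stmtHom (ha : s a = stmt b) :
    edgeImage (stmtHom hs ha) = {into a, out a blank} := by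
  change Set.range ![into a, out a blank] = _
  simp only [Matrix.range_cons, Matrix.range_empty, Set.union_empty, Set.singleton_union]

theorem nodeImage_seqHom (ha : s a = stmt b) (hb : s b = stmt d) :
    nodeImage (seqHom hs ha hb) = {pt a, cmd a, pt d, pt b, cmd b} := by
  change Set.range ![pt a, cmd a, pt d, pt b, cmd b] = _
  simp only [Matrix.range_cons, Matrix.range_empty, Set.union_empty, Set.singleton_union]

theorem edgeImage_seqHom (ha : s a = stmt b) (hb : s b = stmt d) :
    edgeImage (seqHom hs ha hb) = {into a, out a blank, into b, out b blank} := by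
  change Set.range ![into a, out a blank, into b, out b blank] = _
  simp only [Matrix.range_cons, Matrix.range_empty, Set.union_empty, Set.singleton_union]

theorem nodeImage_decisionHom (ha : s a = dec (![a, c] z) c) :
    nodeImage (decisionHom hs ha) = {pt a, cmd a, pt c} := by
  change Set.range ![pt a, cmd a, pt c] = _
  simp only [Matrix.range_cons, Matrix.range_empty, Set.union_empty, Set.singleton_union]

theorem edgeImage_decisionHom (ha : s a = dec (![a, c] z) c) :
    edgeImage (decisionHom hs ha) = {into a, out a t, out a f} := by
  change Set.range ![into a, out a t, out a f] = _
  simp only [Matrix.range_cons, Matrix.range_empty, Set.union_empty, Set.singleton_union]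

theorem nodeImage_branchHom (ha : (s a).label = .decision) (hl : (s a).next l = some d) :
    nodeImage (branchHom hs ha hl) = {cmd a, pt d} := by
  change Set.range ![cmd a, pt d] = _
  simp only [Matrix.range_cons, Matrix.range_empty, Set.union_empty, Set.singleton_union]

theorem edgeImage_branchHom (ha : (s a).label = .decision) (hl : (s a).next l = some d) :
    edgeImage (branchHom hs ha hl) = {out a l} := by
  change Set.range ![out a l] = _
  simp only [Matrix.range_cons, Matrix.range_empty, Set.union_empty]

theorem nodeImage_longBranchHom (ha : (s a).label = .decision)
    (hl : (s a).next l = some b) (hb : s b = stmt d) :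
    nodeImage (longBranchHom hs ha hl hb) = {cmd a, pt d, pt b, cmd b} := by
  change Set.range ![cmd a, pt d, pt b, cmd b] = _
  simp only [Matrix.range_cons, Matrix.range_empty, Set.union_empty, Set.singleton_union]

theorem edgeImage_longBranchHom (ha : (s a).label = .decision)
    (hl : (s a).next l = some b) (hb : s b = stmt d) :
    edgeImage (longBranchHom hs ha hl hb) = {out a l, into b, out b blank} := by
  change Set.range ![out a l, into b, out b blank] = _
  simp only [Matrix.range_cons, Matrix.range_empty, Set.union_empty, Set.singleton_union]

end Images

section Rewrite

variable [DecidableEq α] (hs : s.WellFormed)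

theorem isRewrite_bypass {r : GRule NodeLabel EdgeLabel} (hb : s b = stmt d)
    (h : OnlyRef s b a l) {g : Hom r.L (hs.bypass hb).net.graph} {g' : Hom r.R hs.net.graph}
    (interfaceV : ∀ x, (g.onV (r.left.onV x)).1 = (g'.onV (r.right.onV x)).1)
    (interfaceE : ∀ e, (g.onE (r.left.onE e)).1 = (g'.onE (r.right.onE e)).1)
    {V : Set (NodeName α)} {E : Set (EdgeName α)} (hV : nodeImage g = V)
    (hV' : nodeImage g' = {pt b, cmd b} ∪ V) (hE : edgeImage g = E)
    (hE' : edgeImage g' = {into b, out b blank} ∪ E) (mem_E : out a l ∈ E) :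
    IsRewrite r g g' where
  interfaceV := interfaceV
  interfaceE := interfaceE
  nodes_eq := by rw [nodes_bypass hs hb, hV', hV, Set.sdiff_sdiff]
  edges_eq := by rw [edges_bypass hs hb, hE', hE, Set.sdiff_sdiff]
  src_eq e _ := by cases e <;> rfl
  tgt_eq e he := tgt_bypass hs hb h he.1 fun hea => he.2 (hE ▸ hea ▸ mem_E)
  nodeLabel_eq x hx := nodeLabel_bypass hs hb hx.1
  edgeLabel_eq e _ := by cases e <;> rfl

theorem isRewrite_seq (ha : s a = stmt b) (hb : s b = stmt d) (h : OnlyRef s b a blank) :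
    IsRewrite seq (stmtHom (hs.bypass hb) (next_blank_eq_some_iff.1 (h.next_bypass hs hb)))
      (seqHom hs ha hb) :=
  isRewrite_bypass hs hb h (fun i : Fin 3 => by fin_cases i <;> rfl) nofun
    (nodeImage_stmtHom ..) ((nodeImage_seqHom hs ha hb).trans (by grind))
    (edgeImage_stmtHom ..) ((edgeImage_seqHom hs ha hb).trans (by grind)) (by simp)

theorem isRewrite_branch (ha : (s a).label = .decision) (hb : s b = stmt d)
    (h : OnlyRef s b a l) (ha' : (bypass s b d a).label = .decision) :
    IsRewrite (branchRule l) (branchHom (hs.bypass hb) ha' (h.next_bypass hs hb))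
      (longBranchHom hs ha h.next_eq hb) :=
  isRewrite_bypass hs hb h (fun i : Fin 2 => by fin_cases i <;> rfl) nofun
    (nodeImage_branchHom ..) ((nodeImage_longBranchHom hs ha h.next_eq hb).trans (by grind))
    (edgeImage_branchHom ..) ((edgeImage_longBranchHom hs ha h.next_eq hb).trans (by grind))
    (by simp)

theorem isRewrite_decision (ha : s a = dec (![a, c] z) c) (hs' : (collapse s a c).WellFormed) :
    IsRewrite (decisionRule z) (stmtHom hs' collapse_self) (decisionHom hs ha) where
  interfaceV := fun i : Fin 2 => by fin_cases i <;> rfl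
  interfaceE := nofun
  nodes_eq := congrArg₂ (· \ ·) (nodes_collapse hs hs' ha)
    ((nodeImage_stmtHom ..).trans (nodeImage_decisionHom hs ha).symm)
  edges_eq := calc
    hs'.net.edges \ edgeImage (stmtHom hs' collapse_self)
      = hs'.net.edges \ {into a, out a blank} := by rw [edgeImage_stmtHom]
    _ = hs.net.edges \ {into a, out a t, out a f} := edges_collapse hs hs' ha
    _ = hs.net.edges \ edgeImage (decisionHom hs ha) := by rw [edgeImage_decisionHom]
  src_eq e _ := by cases e <;> rfl
  tgt_eq e he := tgt_collapse hs hs' ⟨he.1, fun h => he.2 ((edgeImage_stmtHom ..).ge h)⟩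
  nodeLabel_eq x hx := nodeLabel_collapse hs hs' fun h =>
    hx.2 ((nodeImage_stmtHom ..).ge (by simp [h]))
  edgeLabel_eq e _ := by cases e <;> rfl

end Rewrite

section Dangling

variable (hs : s.WellFormed)

theorem dangling_iff_onlyRef {r : GRule NodeLabel EdgeLabel} {g : Hom r.L hs.net.graph}
    {E : Set (EdgeName α)} (hb : s b = stmt d) (hab : (s a).next l = some b)
    (hV : deletedNodes g = {pt b, cmd b}) (hE : edgeImage g = {into b, out b blank} ∪ E)
    (mem_E : ∀ a' l', out a' l' ∈ E ↔ a' = a ∧ l' = l) : r.Dangling g ↔ OnlyRef s b a l := by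
  rw [dangling_iff, hV, hE]
  constructor
  · refine fun hd => ⟨hab, fun a' l' h' => (mem_E a' l').1 ?_⟩
    refine (hd (out a' l') ((out_mem_edges hs).2 ⟨b, h'⟩) (.inr ?_)).resolve_left ?_
    · simp [tgt_out hs h']
    · rintro (h | h)
      · cases h
      · cases h
        exact hs.ne_of_stmt hb (next_stmt.1 (hb ▸ h')).2.symm
  · rintro h (y | ⟨y, m⟩) he hinc
    · simp_all
    · obtain ⟨x, hx⟩ := (out_mem_edges hs).1 he
      rw [tgt_out hs hx] at hinc
      by_cases hxb : x = b
      · exact .inr ((mem_E y m).2 (h.unique y m (hxb ▸ hx)))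
      · obtain rfl : y = b := by simpa [hxb] using hinc
        simp_all

theorem dangling_seqHom_iff (ha : s a = stmt b) (hb : s b = stmt d) :
    seq.inv.Dangling (seqHom hs ha hb) ↔ OnlyRef s b a blank := by
  have compl_eq : (Set.range ![0, 1, 2])ᶜ = ({3, 4} : Set (Fin 5)) := by
    ext x
    fin_cases x <;> simp
  refine dangling_iff_onlyRef hs (r := seq.inv) hb (next_blank_eq_some_iff.2 ha) ?_
    (E := {into a, out a blank}) ((edgeImage_seqHom hs ha hb).trans (by grind)) (by simp)
  exact (congrArg (_ '' ·) compl_eq).trans (Set.image_pair ..)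

theorem dangling_longBranchHom_iff (ha : (s a).label = .decision) (hl : (s a).next l = some b)
    (hb : s b = stmt d) :
    (branchRule l).inv.Dangling (longBranchHom hs ha hl hb) ↔ OnlyRef s b a l := by
  have compl_eq : (Set.range ![0, 1])ᶜ = ({2, 3} : Set (Fin 4)) := by
    ext x
    fin_cases x <;> simp
  refine dangling_iff_onlyRef hs (r := (branchRule l).inv) hb hl ?_ (E := {out a l})
    ((edgeImage_longBranchHom hs ha hl hb).trans (by grind)) (by simp)
  exact (congrArg (_ '' ·) compl_eq).trans (Set.image_pair ..)

theorem dangling_decisionHom (ha : s a = dec (![a, c] z) c) :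
    (decisionRule z).inv.Dangling (decisionHom hs ha) := by
  have compl_eq : (Set.range ![0, 2])ᶜ = ({1} : Set (Fin 3)) := by
    ext x
    fin_cases x <;> simp
  have deleted : deletedNodes (r := (decisionRule z).inv) (decisionHom hs ha) = {cmd a} :=
    (congrArg (_ '' ·) compl_eq).trans Set.image_singleton
  refine (dangling_iff (r := (decisionRule z).inv)).2 fun e he hinc =>
    (edgeImage_decisionHom hs ha).ge ?_
  rw [deleted] at hinc
  rcases e with y | ⟨y, m⟩
  · simp_all
  · obtain ⟨x, hx⟩ := (out_mem_edges hs).1 he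
    rw [tgt_out hs hx] at hinc
    obtain rfl : y = a := by simpa using hinc
    rcases next_dec.1 (ha ▸ hx) with ⟨rfl, -⟩ | ⟨rfl, -⟩ <;> simp

end Dangling

section Steps

variable [DecidableEq α] (hs : s.WellFormed)

theorem derivesAt_seqHom (ha : s a = stmt b) (hb : s b = stmt d) (h : OnlyRef s b a blank) :
    seq.inv.DerivesAt (seqHom hs ha hb) (hs.bypass hb).net.graph :=
  (isRewrite_seq hs ha hb h).symm.derivesAt seqHom_injective stmtHom_injective
    ((dangling_seqHom_iff hs ha hb).2 h)

theorem derivesAt_longBranchHom (ha : (s a).label = .decision) (hb : s b = stmt d)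
    (h : OnlyRef s b a l) :
    (branchRule l).inv.DerivesAt (longBranchHom hs ha h.next_eq hb)
      (hs.bypass hb).net.graph := by
  have ha' : (bypass s b d a).label = .decision := by rwa [label_bypass (h.ne hs hb)]
  exact (isRewrite_branch hs ha hb h ha').symm.derivesAt longBranchHom_injective
    branchHom_injective ((dangling_longBranchHom_iff hs ha h.next_eq hb).2 h)

theorem derivesAt_decisionHom (ha : s a = dec (![a, c] z) c) (hs' : (collapse s a c).WellFormed) :
    (decisionRule z).inv.DerivesAt (decisionHom hs ha) hs'.net.graph :=
  (isRewrite_decision hs ha hs').symm.derivesAt decisionHom_injective stmtHom_injective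
    (dangling_decisionHom hs ha)

theorem inverse_step_of_red (h : Red s s') (hs' : s'.WellFormed) :
    system.inverse.Step hs.net.graph hs'.net.graph := by
  cases h with
  | @bypass b d a l hb h =>
    by_cases hl : l = blank
    · subst hl
      exact ⟨_, ⟨seq, mem_rules_iff.2 (.inl rfl), rfl⟩,
        GRule.directDerives_iff_exists_derivesAt.2
          ⟨_, derivesAt_seqHom hs (next_blank_eq_some_iff.1 h.next_eq) hb h⟩⟩
    · exact ⟨_, ⟨branchRule l, mem_rules_iff.2 (.inr (.inr ⟨l, hl, rfl⟩)), rfl⟩,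
        GRule.directDerives_iff_exists_derivesAt.2
          ⟨_, derivesAt_longBranchHom hs (label_eq_decision_of_next h.next_eq hl) hb h⟩⟩
  | @collapse a z c ha hz =>
    obtain ⟨i, rfl⟩ : ∃ i : Fin 2, z = ![a, c] i := Fin.exists_fin_two.2 hz
    exact ⟨_, ⟨decisionRule i, mem_rules_iff.2 (.inr (.inl ⟨i, rfl⟩)), rfl⟩,
      GRule.directDerives_iff_exists_derivesAt.2 ⟨_, derivesAt_decisionHom hs ha hs'⟩⟩

theorem exists_red_of_inverse_step {G H : LGraph NodeLabel EdgeLabel} (hG : Iso G hs.net.graph)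
    (h : system.inverse.Step G H) :
    ∃ s', ∃ hs' : s'.WellFormed, Red s s' ∧ Iso H hs'.net.graph := by
  obtain ⟨_, ⟨r, hr, rfl⟩, h⟩ := h
  obtain ⟨g, h⟩ := GRule.directDerives_iff_exists_derivesAt.1 (h.congr_left hG)
  rcases mem_rules_iff.1 hr with rfl | ⟨z, rfl⟩ | ⟨l, -, rfl⟩
  · obtain ⟨a, b, d, ha, hb, rfl⟩ := exists_eq_seqHom g
    have hab := (dangling_seqHom_iff hs ha hb).1 h.dangling
    exact ⟨_, hs.bypass hb, .bypass hb hab, h.iso (derivesAt_seqHom hs ha hb hab)⟩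
  · obtain ⟨a, c, ha, rfl⟩ := exists_eq_decisionHom g
    have hz : ![a, c] z = a ∨ ![a, c] z = c := by fin_cases z <;> simp
    have hs' := (wellFormed_collapse_iff ha hz).2 hs
    exact ⟨_, hs', .collapse ha hz, h.iso (derivesAt_decisionHom hs ha hs')⟩
  · obtain ⟨a, b, d, ha, hl, hb, rfl⟩ := exists_eq_longBranchHom g
    have hab := (dangling_longBranchHom_iff hs ha hl hb).1 h.dangling
    exact ⟨_, hs.bypass hb, .bypass hb hab, h.iso (derivesAt_longBranchHom hs ha hb hab)⟩

include hs in
theorem exists_subdivision [Infinite α] (h : (s a).next l = some d) :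
    ∃ s' b, s'.WellFormed ∧ s' b = stmt d ∧ OnlyRef s' b a l ∧ s = bypass s' b d := by
  obtain ⟨b, hb⟩ := hs.finite.exists_notMem
  have hb : s b = absent := not_not.1 hb
  exact ⟨subdivide s a l b d, b, hs.subdivide hb h, subdivide_self, onlyRef_subdivide hs hb h,
    (bypass_subdivide hs hb h).symm⟩

include hs in
theorem exists_expansion (ha : s a = stmt c) (z : Fin 2) :
    ∃ s', s'.WellFormed ∧ s' a = dec (![a, c] z) c ∧ s = collapse s' a c := by
  have expand_self : Function.update s a (dec (![a, c] z) c) a = dec (![a, c] z) c :=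
    Function.update_self ..
  have collapse_expand : collapse (Function.update s a (dec (![a, c] z) c)) a c = s := by
    rw [collapse, Function.update_idem, ← ha, Function.update_eq_self]
  have hz : ![a, c] z = a ∨ ![a, c] z = c := by fin_cases z <;> simp
  refine ⟨_, (wellFormed_collapse_iff expand_self hz).1 ?_, expand_self, collapse_expand.symm⟩
  rwa [collapse_expand]

end Steps

theorem exists_net_of_step [Infinite α] {G H : LGraph NodeLabel EdgeLabel}
    (hs : s.WellFormed) (hG : Iso G hs.net.graph) (h : system.Step G H) :
    ∃ s' : Prog α, ∃ hs' : s'.WellFormed, Iso H hs'.net.graph := by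
  classical
  obtain ⟨r, hr, h⟩ := h
  obtain ⟨g, h⟩ := GRule.directDerives_iff_exists_derivesAt.1 (h.congr_left hG)
  rcases mem_rules_iff.1 hr with rfl | ⟨z, rfl⟩ | ⟨l, -, rfl⟩
  · obtain ⟨a, d, ha, rfl⟩ := exists_eq_stmtHom g
    obtain ⟨s, b, hs', hb, hab, rfl⟩ := exists_subdivision hs (next_blank_eq_some_iff.2 ha)
    exact ⟨s, hs', h.iso <|
      (isRewrite_seq hs' (next_blank_eq_some_iff.1 hab.next_eq) hb hab).derivesAt
        stmtHom_injective seqHom_injective h.dangling⟩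
  · obtain ⟨a, c, ha, rfl⟩ := exists_eq_stmtHom g
    obtain ⟨s, hs', ha', rfl⟩ := exists_expansion hs ha z
    exact ⟨s, hs', h.iso <| (isRewrite_decision hs' ha' hs).derivesAt stmtHom_injective
      decisionHom_injective h.dangling⟩
  · obtain ⟨a, d, ha, hl, rfl⟩ := exists_eq_branchHom g
    obtain ⟨s, b, hs', hb, hab, rfl⟩ := exists_subdivision hs hl
    have ha' : (s a).label = .decision := by rwa [label_bypass (hab.ne hs' hb)] at ha
    exact ⟨s, hs', h.iso <| (isRewrite_branch hs' ha' hb hab ha).derivesAt branchHom_injective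
      longBranchHom_injective h.dangling⟩

section Start

/-- The flow program of the start graph: a single statement. -/
def startProg : Prog ℕ
  | 0 => .stmt 1
  | 1 => .exit
  | _ => .absent

theorem eq_zero_or_one_of_startProg {a : ℕ} (h : startProg a ≠ absent) : a = 0 ∨ a = 1 := by
  match a with
  | 0 => exact .inl rfl
  | 1 => exact .inr rfl
  | _ + 2 => exact absurd rfl h

theorem eq_zero_of_label_startProg {a : ℕ} (h : (startProg a).label ≠ .point) : a = 0 := by
  rcases eq_zero_or_one_of_startProg (ne_absent_of_label h) with rfl | rfl
  · rfl
  · exact absurd rfl h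

theorem startProg_zero : startProg 0 = .stmt 1 := rfl

theorem startProg_next {a b : ℕ} (h : (startProg a).next l = some b) :
    a = 0 ∧ l = blank ∧ b = 1 := by
  obtain rfl := eq_zero_of_label_startProg (label_ne_point_of_next h)
  rw [startProg_zero, next_stmt] at h
  exact ⟨rfl, h.imp_right Eq.symm⟩

theorem startProg_wellFormed : startProg.WellFormed where
  finite := (Set.toFinite {0, 1}).subset fun _ => eq_zero_or_one_of_startProg
  halts_of_next a l b h := by
    obtain ⟨-, -, rfl⟩ := startProg_next h
    exact .exit rfl

theorem start_iso : Iso grammar.start startProg_wellFormed.net.graph := by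
  change Iso stmtGraph _
  refine iso_graph_of_surjective (stmtHom_injective (ha := startProg_zero)) ?_ ?_
  · rw [nodeImage_stmtHom]
    rintro (a | a) ha
    · rcases eq_zero_or_one_of_startProg ((pt_mem_nodes _).1 ha) with rfl | rfl <;> simp
    · obtain rfl := eq_zero_of_label_startProg ((cmd_mem_nodes _).1 ha)
      simp
  · rw [edgeImage_stmtHom]
    rintro (a | ⟨a, l⟩) ha
    · obtain rfl := eq_zero_of_label_startProg ((into_mem_edges _).1 ha)
      simp
    · obtain ⟨b, hb⟩ := (out_mem_edges _).1 ha
      obtain ⟨rfl, rfl, -⟩ := startProg_next hb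
      simp

end Start

theorem exists_net_of_cls_mem_language {G : LGraph NodeLabel EdgeLabel}
    (h : G.cls ∈ grammar.language) :
    ∃ s : Prog ℕ, ∃ hs : s.WellFormed, Iso G hs.net.graph :=
  ((GraphGrammar.cls_mem_language_iff rfl).1 h).preserves
    (P := fun G => ∃ s : Prog ℕ, ∃ hs : s.WellFormed, Iso G hs.net.graph)
    (fun _ _ ⟨s, hs, hG⟩ hGH => ⟨s, hs, iso_trans (iso_symm hGH) hG⟩)
    (fun _ _ ⟨_, hs, hG⟩ h => exists_net_of_step hs hG h)
    ⟨startProg, startProg_wellFormed, start_iso⟩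

theorem confluentOn_inverse : system.inverse.ConfluentOn grammar.language :=
  GTSystem.confluentOn_of_simulation (X := {s : Prog ℕ // s.WellFormed})
    (red := fun s s' => Red s.1 s'.1) (fun s => s.2.net.graph)
    (diamond := fun s s₁ _ h₁ h₂ => (h₁.diamond s.2 h₂).imp Subtype.ext
      fun ⟨s₃, h₁₃, h₂₃⟩ => ⟨⟨s₃, h₁₃.wellFormed s₁.2⟩, h₁₃, h₂₃⟩)
    (represented := fun _ hG =>
      have ⟨s, hs, hG⟩ := exists_net_of_cls_mem_language hG
      ⟨⟨s, hs⟩, hG⟩)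
    (step_of_red := fun s s' h => inverse_step_of_red s.2 h s'.2)
    (red_of_step := fun s _ _ hG h =>
      have ⟨s', hs', hred, hH⟩ := exists_red_of_inverse_step s.2 hG h
      ⟨⟨s', hs'⟩, hred, hH⟩)

theorem terminating_inverse : system.inverse.Terminating := by
  refine GTSystem.terminating_of_card_edges_lt ?_
  rintro _ ⟨r, hr, rfl⟩
  rcases mem_rules_iff.1 hr with rfl | ⟨z, rfl⟩ | ⟨l, -, rfl⟩
  · change Nat.card (Fin 2) < Nat.card (Fin 4)
    simp
  · change Nat.card (Fin 2) < Nat.card (Fin 3)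
    simp
  · change Nat.card (Fin 1) < Nat.card (Fin 3)
    simp

end EFD

theorem mainTheorem10 :
    EFD.grammar.system.inverse.EfficientlyRecognises EFD.grammar.terminals EFD.grammar.language :=
  ⟨GraphGrammar.recognises_inverse rfl, EFD.terminating_inverse, EFD.confluentOn_inverse⟩
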